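/- Let $(\Omega,\Sigma,\mu)$ and $(\Omega',\Sigma',\nu)$ be $\sigma$-finite measure spaces, and let $L^0(\mu)$ denote the space of ($\mu$-a.e. equivalence classes of) real measurable functions, with the a.e. order. A Banach lattice on $(\Omega,\Sigma,\mu)$ is a linear subspace $X\subset L^0(\mu)$ with a complete norm such that $X$ contains an a.e. strictly positive element and, whenever $f\in L^0(\mu)$, $g\in X$ and $|f|\le|g|$ a.e., one has $f\in X$ and $\|f\|_X\le\|g\|_X$. It has the Fatou property if, whenever $0\le f_n\in X$, $f_n\uparrow f\in L^0(\mu)$ a.e. and $\sup_n\|f_n\|_X<\infty$, one has $f\in X$ and $\|f_n\|_X\uparrow\|f\|_X$. For Banach lattices $X_0,X_1$ on $(\Omega,\Sigma,\mu)$ and $\theta\in(0,1)$, the Calderón product $X_0^{1-\theta}X_1^\theta$ is the space of all $f\in L^0(\mu)$ such that $|f|\le\lambda|f_0|^{1-\theta}|f_1|^\theta$ a.e. for some $\lambda>0$ and some $f_j\in X_j$ with $\|f_j\|_{X_j}\le1$ $(j=0,1)$. A linear operator $T$ is positive if $Tx\ge0$ for all $x\ge0$ in its domain. An order isomorphism is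 a linear bijection $S$ such that $Sx\wedge Sy=0$ whenever $x\wedge y=0$. **Theorem.** Let $X_0,X_1$ be Banach lattices on $(\Omega,\Sigma,\mu)$ and $Y_0,Y_1$ Banach lattices on $(\Omega',\Sigma',\nu)$, all with the Fatou property. Let $T\colon X_0+X_1\to Y_0+Y_1$ be a positive linear operator whose restriction to $X_j$ is a bounded operator from $X_j$ to $Y_j$ for $j=0,1$. Assume that, for some $\theta_0\in(0,1)$, $T$ restricts to an order isomorphism from $X_0^{1-\theta_0}X_1^{\theta_0}$ onto $Y_0^{1-\theta_0}Y_1^{\theta_0}$. Then for every $\theta_1\in(0,1)$, $T$ restricts to an order isomorphism from $X_0^{1-\theta_1}X_1^{\theta_1}$ onto $Y_0^{1-\theta_1}Y_1^{\theta_1}$. -/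

import Mathlib

open MeasureTheory Filter Topology

/-- A Banach lattice on the measure space `(Ω, μ)`: a linear subspace of the space `L⁰(μ)` of classes
of a.e. equal real measurable functions, with a complete norm, solid in `L⁰(μ)`, and containing
an a.e. strictly positive element. -/
structure BanachFunctionLattice {Ω : Type*} [MeasurableSpace Ω] (μ : Measure Ω) where
  /-- the underlying vector space of functions -/
  space : Submodule ℝ (Ω →ₘ[μ] ℝ)
  /-- the norm -/
  nrm : Seminorm ℝ space
  eq_zero_of_nrm_eq_zero : ∀ f : space, nrm f = 0 → f = 0
  complete : ∀ u : ℕ → space,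
    (∀ ε : ℝ, 0 < ε → ∃ N : ℕ, ∀ m ≥ N, ∀ n ≥ N, nrm (u m - u n) < ε) →
      ∃ f : space, Tendsto (fun n => nrm (u n - f)) atTop (𝓝 0)
  mem_of_abs_le : ∀ f g : Ω →ₘ[μ] ℝ, g ∈ space → |f| ≤ |g| → f ∈ space
  nrm_le_of_abs_le : ∀ f g : space, |(f : Ω →ₘ[μ] ℝ)| ≤ |(g : Ω →ₘ[μ] ℝ)| → nrm f ≤ nrm g
  exists_pos : ∃ w ∈ space, ∀ᵐ t ∂μ, 0 < w t

namespace BanachFunctionLattice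

variable {Ω : Type*} [MeasurableSpace Ω] {μ : Measure Ω}

/-- The Fatou property: if `0 ≤ fₙ ↑ f` a.e. with `fₙ ∈ X`, `f ∈ L⁰(μ)` and `sup ‖fₙ‖ < ∞`, then
`f ∈ X` and `‖fₙ‖ → ‖f‖` (the norms increase, by solidity). -/
def HasFatouProperty (X : BanachFunctionLattice μ) : Prop :=
  ∀ (u : ℕ → X.space) (f : Ω →ₘ[μ] ℝ),
    (∀ n, 0 ≤ (u n : Ω →ₘ[μ] ℝ)) →
    (Monotone fun n => (u n : Ω →ₘ[μ] ℝ)) →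
    (∀ᵐ t ∂μ, Tendsto (fun n => (u n : Ω →ₘ[μ] ℝ) t) atTop (𝓝 (f t))) →
    BddAbove (Set.range fun n => X.nrm (u n)) →
      ∃ hf : f ∈ X.space, Tendsto (fun n => X.nrm (u n)) atTop (𝓝 (X.nrm ⟨f, hf⟩))

theorem coeFn_abs (f : Ω →ₘ[μ] ℝ) : ⇑|f| =ᵐ[μ] fun t => |f t| := by
  have h : |f| = f ⊔ -f := rfl
  rw [h]
  filter_upwards [AEEqFun.coeFn_sup f (-f), AEEqFun.coeFn_neg f] with t h1 h2
  rw [h1, h2]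
  rfl

theorem abs_mem (X : BanachFunctionLattice μ) {f : Ω →ₘ[μ] ℝ} (hf : f ∈ X.space) :
    |f| ∈ X.space := by
  refine X.mem_of_abs_le _ f hf (AEEqFun.coeFn_le.mp ?_)
  filter_upwards [coeFn_abs f, coeFn_abs |f|] with t h1 h2
  rw [h2, h1, abs_abs]

/-- Rescaling to the unit ball: a bound by elements of `X₀`, `X₁` gives one by elements of norm at
most one. -/
theorem exists_normalized (X₀ X₁ : BanachFunctionLattice μ) {θ : ℝ}
    (f : Ω →ₘ[μ] ℝ) (g₀ : X₀.space) (g₁ : X₁.space)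
    (h : ∀ᵐ t ∂μ, |f t| ≤ |(g₀ : Ω →ₘ[μ] ℝ) t| ^ (1 - θ) * |(g₁ : Ω →ₘ[μ] ℝ) t| ^ θ) :
    ∃ c : ℝ, 0 < c ∧ ∃ f₀ : X₀.space, ∃ f₁ : X₁.space, X₀.nrm f₀ ≤ 1 ∧ X₁.nrm f₁ ≤ 1 ∧
      ∀ᵐ t ∂μ, |f t| ≤ c * (|(f₀ : Ω →ₘ[μ] ℝ) t| ^ (1 - θ) * |(f₁ : Ω →ₘ[μ] ℝ) t| ^ θ) := by
  set c : ℝ := X₀.nrm g₀ + X₁.nrm g₁ + 1 with hc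
  have h0 : 0 ≤ X₀.nrm g₀ := apply_nonneg _ _
  have h1 : 0 ≤ X₁.nrm g₁ := apply_nonneg _ _
  have hcpos : 0 < c := by positivity
  have hinv : ‖c⁻¹‖ = c⁻¹ := by rw [Real.norm_eq_abs, abs_of_pos (inv_pos.mpr hcpos)]
  refine ⟨c, hcpos, c⁻¹ • g₀, c⁻¹ • g₁, ?_, ?_, ?_⟩
  · rw [map_smul_eq_mul, hinv, inv_mul_le_iff₀ hcpos]; linarith
  · rw [map_smul_eq_mul, hinv, inv_mul_le_iff₀ hcpos]; linarith
  · filter_upwards [h, AEEqFun.coeFn_smul c⁻¹ (g₀ : Ω →ₘ[μ] ℝ),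
      AEEqFun.coeFn_smul c⁻¹ (g₁ : Ω →ₘ[μ] ℝ)] with t ht e0 e1
    refine ht.trans (le_of_eq ?_)
    rw [Submodule.coe_smul, Submodule.coe_smul, e0, e1, Pi.smul_apply, Pi.smul_apply, smul_eq_mul,
      smul_eq_mul, abs_mul, abs_mul, abs_of_pos (inv_pos.mpr hcpos),
      Real.mul_rpow (inv_pos.mpr hcpos).le (abs_nonneg _),
      Real.mul_rpow (inv_pos.mpr hcpos).le (abs_nonneg _)]
    have e : c⁻¹ ^ (1 - θ) * c⁻¹ ^ θ = c⁻¹ := by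
      rw [← Real.rpow_add (inv_pos.mpr hcpos)]; simp
    set a := |(g₀ : Ω →ₘ[μ] ℝ) t| ^ (1 - θ)
    set b := |(g₁ : Ω →ₘ[μ] ℝ) t| ^ θ
    calc a * b = c * c⁻¹ * (a * b) := by rw [mul_inv_cancel₀ hcpos.ne', one_mul]
      _ = c * (c⁻¹ ^ (1 - θ) * c⁻¹ ^ θ) * (a * b) := by rw [e]
      _ = _ := by ring

/-- Hölder's inequality for two terms. -/
theorem holder_two {θ : ℝ} (hθ : θ ∈ Set.Ioo (0 : ℝ) 1) {a b x y : ℝ} (ha : 0 ≤ a) (hb : 0 ≤ b)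
    (hx : 0 ≤ x) (hy : 0 ≤ y) :
    a ^ (1 - θ) * x ^ θ + b ^ (1 - θ) * y ^ θ ≤ (a + b) ^ (1 - θ) * (x + y) ^ θ := by
  have hθ0 : 0 < θ := hθ.1
  have hθ1 : 0 < 1 - θ := by linarith [hθ.2]
  rcases (add_nonneg ha hb).eq_or_lt with hs | hs
  · have ha0 : a = 0 := by linarith
    have hb0 : b = 0 := by linarith
    simp [ha0, hb0, Real.zero_rpow hθ1.ne']
  rcases (add_nonneg hx hy).eq_or_lt with hr | hr
  · have hx0 : x = 0 := by linarith
    have hy0 : y = 0 := by linarith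
    simp [hx0, hy0, Real.zero_rpow hθ0.ne']
  have key : ∀ u v : ℝ, 0 ≤ u → 0 ≤ v → u ^ (1 - θ) * v ^ θ ≤
      ((1 - θ) * (u / (a + b)) + θ * (v / (x + y))) * ((a + b) ^ (1 - θ) * (x + y) ^ θ) := by
    intro u v hu hv
    have h := Real.geom_mean_le_arith_mean2_weighted hθ1.le hθ0.le (div_nonneg hu hs.le)
      (div_nonneg hv hr.le) (by ring)
    have hpos : 0 < (a + b) ^ (1 - θ) * (x + y) ^ θ := by positivity
    rw [Real.div_rpow hu hs.le, Real.div_rpow hv hr.le, div_mul_div_comm, div_le_iff₀ hpos] at h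
    exact h
  have h1 := key a x ha hx
  have h2 := key b y hb hy
  have hsum : ((1 - θ) * (a / (a + b)) + θ * (x / (x + y))) +
      ((1 - θ) * (b / (a + b)) + θ * (y / (x + y))) = 1 := by
    field_simp
    ring
  calc _ ≤ _ := add_le_add h1 h2
    _ = _ := by rw [← add_mul, hsum, one_mul]

/-- The Calderón product `X₀^{1-θ} X₁^θ`: all `f ∈ L⁰(μ)` with `|f| ≤ c |f₀|^{1-θ} |f₁|^θ` a.e. for
some `c > 0` and some `f₀`, `f₁` in the closed unit balls of `X₀`, `X₁`. -/
def calderonProduct (X₀ X₁ : BanachFunctionLattice μ) (θ : ℝ) (hθ : θ ∈ Set.Ioo (0 : ℝ) 1) :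
    Submodule ℝ (Ω →ₘ[μ] ℝ) where
  carrier := {f | ∃ c : ℝ, 0 < c ∧ ∃ f₀ : X₀.space, ∃ f₁ : X₁.space,
    X₀.nrm f₀ ≤ 1 ∧ X₁.nrm f₁ ≤ 1 ∧
      ∀ᵐ t ∂μ, |f t| ≤ c * (|(f₀ : Ω →ₘ[μ] ℝ) t| ^ (1 - θ) * |(f₁ : Ω →ₘ[μ] ℝ) t| ^ θ)}
  zero_mem' := by
    refine ⟨1, one_pos, 0, 0, by simp, by simp, ?_⟩
    filter_upwards [AEEqFun.coeFn_zero (μ := μ) (β := ℝ)] with t ht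
    rw [ht]
    simp only [Pi.zero_apply, abs_zero]
    positivity
  smul_mem' := by
    rintro r f ⟨c, hc, f₀, f₁, h0, h1, h⟩
    refine ⟨(|r| + 1) * c, by positivity, f₀, f₁, h0, h1, ?_⟩
    filter_upwards [h, AEEqFun.coeFn_smul r f] with t ht e
    rw [e, Pi.smul_apply, smul_eq_mul, abs_mul, mul_assoc]
    exact mul_le_mul (by linarith) ht (abs_nonneg _) (by positivity)
  add_mem' := by
    rintro f g ⟨c, hc, f₀, f₁, h0, h1, hf⟩ ⟨d, hd, g₀, g₁, k0, k1, hg⟩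
    refine exists_normalized X₀ X₁ (f + g)
      (c • ⟨_, X₀.abs_mem f₀.2⟩ + d • ⟨_, X₀.abs_mem g₀.2⟩)
      (c • ⟨_, X₁.abs_mem f₁.2⟩ + d • ⟨_, X₁.abs_mem g₁.2⟩) ?_
    have hco : ∀ u v : Ω →ₘ[μ] ℝ, ∀ᵐ t ∂μ, (c • |u| + d • |v|) t = c * |u t| + d * |v t| := by
      intro u v
      filter_upwards [AEEqFun.coeFn_add (c • |u|) (d • |v|), AEEqFun.coeFn_smul c |u|,
        AEEqFun.coeFn_smul d |v|, coeFn_abs u, coeFn_abs v] with t e1 e2 e3 e4 e5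
      simp [e1, e2, e3, e4, e5]
    have hp : ∀ e : ℝ, 0 < e → e ^ (1 - θ) * e ^ θ = e := by
      intro e he
      rw [← Real.rpow_add he]; simp
    filter_upwards [hf, hg, AEEqFun.coeFn_add f g, hco f₀ g₀, hco f₁ g₁] with t hft hgt e e0 e1
    have hs : ∀ e a b : ℝ, 0 < e → 0 ≤ a → 0 ≤ b →
        e * (a ^ (1 - θ) * b ^ θ) = (e * a) ^ (1 - θ) * (e * b) ^ θ := by
      intro e a b he ha hb
      rw [Real.mul_rpow he.le ha, Real.mul_rpow he.le hb]
      nth_rewrite 1 [← hp e he]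
      ring
    rw [hs c _ _ hc (abs_nonneg _) (abs_nonneg _)] at hft
    rw [hs d _ _ hd (abs_nonneg _) (abs_nonneg _)] at hgt
    rw [e, Pi.add_apply]
    simp only [Submodule.coe_add, Submodule.coe_smul]
    rw [e0, e1, abs_of_nonneg (by positivity : 0 ≤ c * |(f₀ : Ω →ₘ[μ] ℝ) t| + d * |(g₀ : Ω →ₘ[μ] ℝ) t|),
      abs_of_nonneg (by positivity : 0 ≤ c * |(f₁ : Ω →ₘ[μ] ℝ) t| + d * |(g₁ : Ω →ₘ[μ] ℝ) t|)]
    exact ((abs_add_le _ _).trans (add_le_add hft hgt)).trans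
      (holder_two hθ (by positivity) (by positivity) (by positivity) (by positivity))

end BanachFunctionLattice

section Operators

variable {Ω Ω' : Type*} [MeasurableSpace Ω] [MeasurableSpace Ω'] {μ : Measure Ω} {ν : Measure Ω'}

/-- A linear operator between spaces of functions is positive if it maps nonnegative elements to
nonnegative elements. -/
def IsPositiveOperator {D : Submodule ℝ (Ω →ₘ[μ] ℝ)} {R : Submodule ℝ (Ω' →ₘ[ν] ℝ)}
    (T : D →ₗ[ℝ] R) : Prop :=
  ∀ x : D, 0 ≤ (x : Ω →ₘ[μ] ℝ) → 0 ≤ (T x : Ω' →ₘ[ν] ℝ)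

/-- An order isomorphism: a linear bijection `S` with `S x ⊓ S y = 0` whenever `x ⊓ y = 0`. -/
structure IsLatticeIso {E : Submodule ℝ (Ω →ₘ[μ] ℝ)} {F : Submodule ℝ (Ω' →ₘ[ν] ℝ)}
    (S : E →ₗ[ℝ] F) : Prop where
  inf_eq_zero : ∀ x y : E, (x : Ω →ₘ[μ] ℝ) ⊓ (y : Ω →ₘ[μ] ℝ) = 0 →
    (S x : Ω' →ₘ[ν] ℝ) ⊓ (S y : Ω' →ₘ[ν] ℝ) = 0
  bijective : Function.Bijective S

/-- `T : E → F` is an order isomorphism: `E` lies in the domain of `T`, `T` maps `E` into `F`, and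
the resulting linear operator from `E` to `F` is an order isomorphism. -/
def RestrictsToLatticeIso {D : Submodule ℝ (Ω →ₘ[μ] ℝ)} {R : Submodule ℝ (Ω' →ₘ[ν] ℝ)}
    (T : D →ₗ[ℝ] R) (E : Submodule ℝ (Ω →ₘ[μ] ℝ)) (F : Submodule ℝ (Ω' →ₘ[ν] ℝ)) : Prop :=
  ∃ S : E →ₗ[ℝ] F,
    (∀ x : E, ∃ hx : (x : Ω →ₘ[μ] ℝ) ∈ D, (S x : Ω' →ₘ[ν] ℝ) = T ⟨x, hx⟩) ∧ IsLatticeIso S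

/-- `T : (X₀, X₁) → (Y₀, Y₁)` is an operator between couples: the linear map `T : X₀ + X₁ → Y₀ + Y₁`
restricts to a bounded operator from `X₀` to `Y₀` and to a bounded operator from `X₁` to `Y₁`. -/
structure IsCoupleOperator {X₀ X₁ : BanachFunctionLattice μ} {Y₀ Y₁ : BanachFunctionLattice ν}
    (T : ↥(X₀.space ⊔ X₁.space) →ₗ[ℝ] ↥(Y₀.space ⊔ Y₁.space)) : Prop where
  bounded_zero : ∃ C : ℝ, ∀ x : X₀.space,
    ∃ hy : (T ⟨x, Submodule.mem_sup_left x.2⟩ : Ω' →ₘ[ν] ℝ) ∈ Y₀.space, Y₀.nrm ⟨_, hy⟩ ≤ C * X₀.nrm x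
  bounded_one : ∃ C : ℝ, ∀ x : X₁.space,
    ∃ hy : (T ⟨x, Submodule.mem_sup_right x.2⟩ : Ω' →ₘ[ν] ℝ) ∈ Y₁.space, Y₁.nrm ⟨_, hy⟩ ≤ C * X₁.nrm x

end Operators

/-! Write G_η(a, b) = |a|^(1-η) |b|^η. For a, b ≥ 0, Young's inequality with dyadic scaling exhibits
G_η(a, b), up to a factor 3, as the infimum of the linear majorants 2^(jη) a + 2^(j(η-1)) b. A
positive operator respects these majorants, so τ G_η(a, b) ≤ 3 G_η(τ a, τ b) and τ maps Calderón
products into Calderón products (`map_le_geomMean`). If a and b lie in X₀ ∩ X₁ and are comparable,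
finitely many majorants suffice. They lie in the θ-product, where τ preserves finite infima, and the
reverse inequality follows for every η (`geomMean_map_le`).

The space X₀ ∩ X₁ lies in every Calderón product, and truncation approximates each product by it
with an error that is a null sequence times a fixed element of X₀ + X₁. Disjointness preservation,
injectivity and solidity of the range therefore pass from θ to η. By solidity, surjectivity reduces
to dominating each G_η(y₀, y₁) by some τ f.

For y₀, y₁ in the unit balls, boundedness of the inverse at θ and the comparison of means
(`exists_geomMean_comparable`) give G_θ(y₀, y₁) ≤ C G_θ(z₀, z₁), where G_η(z₀, z₁) ≤ 3 τ G_η(x₀, x₁)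
for all η. Pointwise, y₀ can exceed a large multiple of z₀ only where y₁ is a tiny multiple of z₁,
and vice versa. Hence G_η(y₀, y₁) ≤ M G_η(z₀, z₁) plus a small multiple of G_η(y₀ + z₀, y₁ + z₁).
The small term is a mean of the same kind, and iteration removes it (`exists_geomMean_le_map`). -/

/-! ### Pointwise inequalities for weighted geometric means of real numbers. -/

section RealInequalities

/-- Young's inequality with a scaling parameter. -/
theorem rpow_mul_rpow_le_scaled_add {θ : ℝ} (hθ : θ ∈ Set.Ioo (0 : ℝ) 1) {a b s : ℝ} (ha : 0 ≤ a)
    (hb : 0 ≤ b) (hs : 0 < s) : a ^ (1 - θ) * b ^ θ ≤ s ^ θ * a + s ^ (θ - 1) * b := by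
  have hθ0 : 0 < θ := hθ.1
  have hθ1 : 0 < 1 - θ := by linarith [hθ.2]
  have hp : 0 ≤ s ^ θ * a := by positivity
  have hq : 0 ≤ s ^ (θ - 1) * b := by positivity
  have h := Real.geom_mean_le_arith_mean2_weighted hθ1.le hθ0.le hp hq (by ring)
  rw [Real.mul_rpow (by positivity) ha, Real.mul_rpow (by positivity) hb, ← Real.rpow_mul hs.le,
    ← Real.rpow_mul hs.le] at h
  have e : s ^ (θ * (1 - θ)) * s ^ ((θ - 1) * θ) = 1 := by
    rw [← Real.rpow_add hs]; ring_nf; simp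
  have : a ^ (1 - θ) * b ^ θ =
      s ^ (θ * (1 - θ)) * a ^ (1 - θ) * (s ^ ((θ - 1) * θ) * b ^ θ) := by
    rw [mul_mul_mul_comm, e, one_mul]
  rw [this]
  nlinarith

/-- Young's inequality is sharp at s = b / a. Within a factor 2 of that scale, the first summand
costs at most one copy of the mean and the second at most two. -/
theorem scaled_add_le_rpow_mul_rpow {θ : ℝ} (hθ : θ ∈ Set.Ioo (0 : ℝ) 1) {a b s : ℝ} (ha : 0 < a)
    (hb : 0 < b) (hs : 0 < s) (h1 : s ≤ b / a) (h2 : b / a ≤ 2 * s) :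
    s ^ θ * a + s ^ (θ - 1) * b ≤ 3 * (a ^ (1 - θ) * b ^ θ) := by
  have hθ0 : 0 < θ := hθ.1
  have hθ1 : 0 < 1 - θ := by linarith [hθ.2]
  have hr : 0 < b / a := by positivity
  have e1 : (b / a) ^ θ * a = a ^ (1 - θ) * b ^ θ := by
    rw [Real.div_rpow hb.le ha.le, Real.rpow_sub ha, Real.rpow_one]; ring
  have h3 : s ^ θ * a ≤ a ^ (1 - θ) * b ^ θ := by
    rw [← e1]; gcongr
  have h4 : s ^ (θ - 1) * b ≤ 2 * (a ^ (1 - θ) * b ^ θ) := by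
    have h5 : s ^ (θ - 1) * s = s ^ θ := by
      rw [← Real.rpow_add_one hs.ne']; ring_nf
    have h6 : b ≤ 2 * s * a := (div_le_iff₀ ha).mp h2
    calc s ^ (θ - 1) * b ≤ s ^ (θ - 1) * (2 * s * a) := by gcongr
      _ = 2 * (s ^ (θ - 1) * s * a) := by ring
      _ = 2 * (s ^ θ * a) := by rw [h5]
      _ ≤ _ := by linarith
  linarith

theorem exists_zpow_scaled_add_le {θ : ℝ} (hθ : θ ∈ Set.Ioo (0 : ℝ) 1) {a b : ℝ} (ha : 0 < a)
    (hb : 0 < b) : ∃ j : ℤ, (2 : ℝ) ^ j ≤ b / a ∧ b / a < (2 : ℝ) ^ (j + 1) ∧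
      ((2 : ℝ) ^ j) ^ θ * a + ((2 : ℝ) ^ j) ^ (θ - 1) * b ≤ 3 * (a ^ (1 - θ) * b ^ θ) := by
  obtain ⟨j, h1, h2⟩ := exists_mem_Ico_zpow (div_pos hb ha) (one_lt_two : (1 : ℝ) < 2)
  refine ⟨j, h1, h2, scaled_add_le_rpow_mul_rpow hθ ha hb (by positivity) h1 ?_⟩
  rw [zpow_add_one₀ two_ne_zero] at h2
  linarith

/-- For a, b > 0 the dyadic scale just below b / a does it. If a = 0 or b = 0, letting j tend to +∞
or -∞ respectively sends the remaining summand to 0. -/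
theorem le_rpow_mul_rpow_of_forall_zpow {θ : ℝ} (hθ : θ ∈ Set.Ioo (0 : ℝ) 1) {a b c : ℝ}
    (ha : 0 ≤ a) (hb : 0 ≤ b)
    (h : ∀ j : ℤ, c ≤ ((2 : ℝ) ^ j) ^ θ * a + ((2 : ℝ) ^ j) ^ (θ - 1) * b) :
    c ≤ 3 * (a ^ (1 - θ) * b ^ θ) := by
  have hθ0 : 0 < θ := hθ.1
  have hθ1 : 0 < 1 - θ := by linarith [hθ.2]
  rcases ha.eq_or_lt with rfl | ha
  · rw [Real.zero_rpow hθ1.ne']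
    have h1 : Tendsto (fun n : ℕ => ((2 : ℝ) ^ (θ - 1)) ^ n * b) atTop (𝓝 (0 * b)) :=
      (tendsto_pow_atTop_nhds_zero_of_lt_one (by positivity)
        (Real.rpow_lt_one_of_one_lt_of_neg one_lt_two (by linarith))).mul_const b
    have h2 := ge_of_tendsto' h1 (b := c) fun n => by
      have := h n
      rw [Real.rpow_pow_comm zero_le_two]
      simpa using this
    linarith
  rcases hb.eq_or_lt with rfl | hb
  · rw [Real.zero_rpow hθ0.ne']
    have h1 : Tendsto (fun n : ℕ => ((2⁻¹ : ℝ) ^ θ) ^ n * a) atTop (𝓝 (0 * a)) :=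
      (tendsto_pow_atTop_nhds_zero_of_lt_one (by positivity)
        (Real.rpow_lt_one (by norm_num) (by norm_num) hθ0)).mul_const a
    have h2 := ge_of_tendsto' h1 (b := c) fun n => by
      have := h (-n)
      rw [Real.rpow_pow_comm (by norm_num)]
      simpa using this
    linarith
  · obtain ⟨j, -, -, hj⟩ := exists_zpow_scaled_add_le hθ ha hb
    exact (h j).trans hj

/-- Comparability confines the near-optimal scale to |j| ≤ m. A finite family matters because a
lattice homomorphism preserves only finite infima. -/
theorem le_rpow_mul_rpow_of_forall_zpow_le {θ : ℝ} (hθ : θ ∈ Set.Ioo (0 : ℝ) 1) {a b c : ℝ} {m : ℕ}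
    (ha : 0 ≤ a) (hb : 0 ≤ b) (hab : a ≤ 2 ^ m * b) (hba : b ≤ 2 ^ m * a)
    (h : ∀ j : ℤ, |j| ≤ m → c ≤ ((2 : ℝ) ^ j) ^ θ * a + ((2 : ℝ) ^ j) ^ (θ - 1) * b) :
    c ≤ 3 * (a ^ (1 - θ) * b ^ θ) := by
  have hθ0 : 0 < θ := hθ.1
  have hθ1 : 0 < 1 - θ := by linarith [hθ.2]
  rcases ha.eq_or_lt with rfl | ha
  · obtain rfl : b = 0 := by linarith
    have := h 0 (by simp)
    simp at this
    rw [Real.zero_rpow hθ1.ne']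
    linarith
  rcases hb.eq_or_lt with rfl | hb
  · linarith
  obtain ⟨j, h1, h2, hj⟩ := exists_zpow_scaled_add_le hθ ha hb
  refine (h j (abs_le.mpr ⟨?_, ?_⟩)).trans hj
  · have : (2 : ℝ) ^ (-(m : ℤ)) < 2 ^ (j + 1) := by
      refine lt_of_le_of_lt ?_ h2
      rw [zpow_neg, zpow_natCast, le_div_iff₀ ha, inv_mul_le_iff₀ (by positivity)]
      exact hab
    have := (zpow_lt_zpow_iff_right₀ (one_lt_two : (1 : ℝ) < 2)).mp this
    omega
  · have : (2 : ℝ) ^ j ≤ 2 ^ (m : ℤ) := by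
      refine h1.trans ?_
      rw [zpow_natCast, div_le_iff₀ ha]
      exact hba
    exact (zpow_le_zpow_iff_right₀ (one_lt_two : (1 : ℝ) < 2)).mp this

/-- The error made when two functions are truncated against multiples of each other. -/
noncomputable def truncationError (θ : ℝ) (m : ℕ) : ℝ :=
  (((2 : ℝ)⁻¹) ^ θ) ^ m + (((2 : ℝ)⁻¹) ^ (1 - θ)) ^ m

theorem truncationError_nonneg (θ : ℝ) (m : ℕ) : 0 ≤ truncationError θ m := by
  unfold truncationError
  positivity

theorem tendsto_truncationError {θ : ℝ} (hθ : θ ∈ Set.Ioo (0 : ℝ) 1) :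
    Tendsto (truncationError θ) atTop (𝓝 0) := by
  have h : ∀ s : ℝ, 0 < s → Tendsto (fun m : ℕ => (((2 : ℝ)⁻¹) ^ s) ^ m) atTop (𝓝 0) := fun s hs =>
    tendsto_pow_atTop_nhds_zero_of_lt_one (by positivity)
      (Real.rpow_lt_one (by norm_num) (by norm_num) hs)
  rw [← add_zero (0 : ℝ)]
  exact (h θ hθ.1).add (h (1 - θ) (by linarith [hθ.2]))

/-- Where a truncation is active, one entry is at most 2^(-m) times the other, so the whole mean is
absorbed by the error term. -/
theorem rpow_mul_rpow_le_truncation {θ : ℝ} (hθ : θ ∈ Set.Ioo (0 : ℝ) 1) {a b : ℝ} (ha : 0 ≤ a)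
    (hb : 0 ≤ b) (m : ℕ) : a ^ (1 - θ) * b ^ θ ≤
      (a ⊓ 2 ^ m * b) ^ (1 - θ) * (b ⊓ 2 ^ m * a) ^ θ + truncationError θ m * (a + b) := by
  have hθ0 : 0 < θ := hθ.1
  have hθ1 : 0 < 1 - θ := by linarith [hθ.2]
  have h1 : 0 ≤ (a ⊓ 2 ^ m * b) ^ (1 - θ) * (b ⊓ 2 ^ m * a) ^ θ := by
    have : 0 ≤ a ⊓ 2 ^ m * b := le_inf ha (by positivity)
    have : 0 ≤ b ⊓ 2 ^ m * a := le_inf hb (by positivity)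
    positivity
  unfold truncationError
  rw [Real.rpow_pow_comm (by norm_num), Real.rpow_pow_comm (by norm_num), inv_pow]
  set N : ℝ := 2 ^ m with hN
  have hNpos : 0 < N := by positivity
  have hinv : 0 < N⁻¹ := by positivity
  have key : ∀ a θ : ℝ, 0 ≤ a → 0 < 1 - θ → 0 < θ → a ^ (1 - θ) * (N⁻¹ * a) ^ θ = N⁻¹ ^ θ * a := by
    intro a θ ha h1 h2
    rcases ha.eq_or_lt with rfl | ha
    · simp [Real.zero_rpow h1.ne']
    rw [Real.mul_rpow hinv.le ha.le, mul_left_comm, ← Real.rpow_add ha]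
    simp
  rcases le_or_gt a (N * b) with hab | hab
  · rcases le_or_gt b (N * a) with hba | hba
    · rw [inf_eq_left.mpr hab, inf_eq_left.mpr hba]
      have : 0 ≤ (N⁻¹ ^ θ + N⁻¹ ^ (1 - θ)) * (a + b) := by positivity
      linarith
    · have h2 : a ≤ N⁻¹ * b := by rw [le_inv_mul_iff₀ hNpos]; exact hba.le
      have h3 : a ^ (1 - θ) * b ^ θ ≤ N⁻¹ ^ (1 - θ) * b := by
        rw [← key b (1 - θ) hb (by linarith) hθ1, sub_sub_cancel, mul_comm]
        gcongr
      have : 0 ≤ N⁻¹ ^ θ * (a + b) + N⁻¹ ^ (1 - θ) * a := by positivity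
      linarith
  · have h2 : b ≤ N⁻¹ * a := by rw [le_inv_mul_iff₀ hNpos]; exact hab.le
    have h3 : a ^ (1 - θ) * b ^ θ ≤ N⁻¹ ^ θ * a := by
      rw [← key a θ ha hθ1 hθ0]
      gcongr
    have : 0 ≤ N⁻¹ ^ θ * b + N⁻¹ ^ (1 - θ) * (a + b) := by positivity
    linarith

theorem le_mul_of_rpow_mul_rpow_le {θ : ℝ} (hθ : θ ∈ Set.Ioo (0 : ℝ) 1) {a b c d C M ε : ℝ}
    (hc : 0 ≤ c) (hd : 0 ≤ d) (hM : 0 ≤ M) (hε : 0 ≤ ε)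
    (h : a ^ (1 - θ) * b ^ θ ≤ C * (c ^ (1 - θ) * d ^ θ)) (hac : M * c < a)
    (hC : C ≤ M ^ (1 - θ) * ε ^ θ) : b ≤ ε * d := by
  have hθ0 : 0 < θ := hθ.1
  have hθ1 : 0 < 1 - θ := by linarith [hθ.2]
  by_contra! hbd
  have h1 : (M * c) ^ (1 - θ) * (ε * d) ^ θ < a ^ (1 - θ) * b ^ θ :=
    mul_lt_mul'' (Real.rpow_lt_rpow (by positivity) hac hθ1)
      (Real.rpow_lt_rpow (by positivity) hbd hθ0) (by positivity) (by positivity)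
  rw [Real.mul_rpow hM hc, Real.mul_rpow hε hd] at h1
  have h2 : C * (c ^ (1 - θ) * d ^ θ) ≤ M ^ (1 - θ) * ε ^ θ * (c ^ (1 - θ) * d ^ θ) := by gcongr
  linarith

/-- This is the change of exponent. Where a > M c, the θ-inequality forces b ≤ ε d; where b > M d,
it forces a ≤ ε c. In both cases the η-mean is small relative to the sums. Elsewhere a ≤ M c and b ≤
M d, and the bound is direct. -/
theorem rpow_mul_rpow_le_of_other_exponent {θ η : ℝ} (hθ : θ ∈ Set.Ioo (0 : ℝ) 1)
    (hη : η ∈ Set.Ioo (0 : ℝ) 1)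
    {a b c d C M ε : ℝ} (ha : 0 ≤ a) (hb : 0 ≤ b) (hc : 0 ≤ c) (hd : 0 ≤ d) (hM : 0 ≤ M)
    (hε : 0 ≤ ε) (h : a ^ (1 - θ) * b ^ θ ≤ C * (c ^ (1 - θ) * d ^ θ))
    (hC : C ≤ M ^ (1 - θ) * ε ^ θ) (hC' : C ≤ M ^ θ * ε ^ (1 - θ)) :
    a ^ (1 - η) * b ^ η ≤ M * (c ^ (1 - η) * d ^ η) +
      (ε ^ η + ε ^ (1 - η)) * ((a + c) ^ (1 - η) * (b + d) ^ η) := by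
  have hη0 : 0 < η := hη.1
  have hη1 : 0 < 1 - η := by linarith [hη.2]
  have p1 : 0 ≤ M * (c ^ (1 - η) * d ^ η) := by positivity
  have p2 : 0 ≤ ε ^ η * ((a + c) ^ (1 - η) * (b + d) ^ η) := by positivity
  have p3 : 0 ≤ ε ^ (1 - η) * ((a + c) ^ (1 - η) * (b + d) ^ η) := by positivity
  rw [add_mul]
  rcases lt_or_ge (M * c) a with hac | hac
  · have h1 := le_mul_of_rpow_mul_rpow_le hθ hc hd hM hε h hac hC
    have : a ^ (1 - η) * b ^ η ≤ ε ^ η * ((a + c) ^ (1 - η) * (b + d) ^ η) := by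
      calc a ^ (1 - η) * b ^ η ≤ (a + c) ^ (1 - η) * (ε * (b + d)) ^ η := by
            gcongr
            · linarith
            · nlinarith
        _ = _ := by rw [Real.mul_rpow hε (by positivity)]; ring
    linarith
  rcases lt_or_ge (M * d) b with hbd | hbd
  · have hθ' : 1 - θ ∈ Set.Ioo (0 : ℝ) 1 := ⟨by linarith [hθ.2], by linarith [hθ.1]⟩
    have h1 := le_mul_of_rpow_mul_rpow_le (a := b) (b := a) (c := d) (d := c) (C := C)
      hθ' hd hc hM hε (by rw [sub_sub_cancel, mul_comm, mul_comm (d ^ θ)]; exact h) hbd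
      (by rw [sub_sub_cancel]; exact hC')
    have : a ^ (1 - η) * b ^ η ≤ ε ^ (1 - η) * ((a + c) ^ (1 - η) * (b + d) ^ η) := by
      calc a ^ (1 - η) * b ^ η ≤ (ε * (a + c)) ^ (1 - η) * (b + d) ^ η := by
            gcongr
            · nlinarith
            · linarith
        _ = _ := by rw [Real.mul_rpow hε (by positivity)]; ring
    linarith
  · have : a ^ (1 - η) * b ^ η ≤ M * (c ^ (1 - η) * d ^ η) := by
      calc a ^ (1 - η) * b ^ η ≤ (M * c) ^ (1 - η) * (M * d) ^ η := by gcongr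
        _ = M * (c ^ (1 - η) * d ^ η) := by
          rw [Real.mul_rpow hM hc, Real.mul_rpow hM hd]
          rcases hM.eq_or_lt with rfl | hM
          · simp [Real.zero_rpow hη1.ne']
          have : M ^ (1 - η) * M ^ η = M := by rw [← Real.rpow_add hM]; simp
          calc _ = M ^ (1 - η) * M ^ η * (c ^ (1 - η) * d ^ η) := by ring
            _ = _ := by rw [this]
    linarith

/-- The order of choice matters: δ fixes ε, and then M is taken large enough to beat C with that ε.
-/
theorem exists_threshold {θ η : ℝ} (hθ : θ ∈ Set.Ioo (0 : ℝ) 1) (hη : η ∈ Set.Ioo (0 : ℝ) 1)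
    (C : ℝ) {δ : ℝ} (hδ : 0 < δ) : ∃ ε M : ℝ, 0 < ε ∧ 0 < M ∧ ε ^ η + ε ^ (1 - η) ≤ δ ∧
      C ≤ M ^ (1 - θ) * ε ^ θ ∧ C ≤ M ^ θ * ε ^ (1 - θ) := by
  have hθ1 : 0 < 1 - θ := by linarith [hθ.2]
  have hη1 : 0 < 1 - η := by linarith [hη.2]
  have h1 : Tendsto (fun n : ℕ => (((2 : ℝ)⁻¹) ^ n) ^ η + (((2 : ℝ)⁻¹) ^ n) ^ (1 - η)) atTop
      (𝓝 0) := by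
    refine (tendsto_truncationError hη).congr fun n => ?_
    rw [truncationError, Real.rpow_pow_comm (by norm_num), Real.rpow_pow_comm (by norm_num)]
  obtain ⟨n, hn⟩ := (h1.eventually_le_const hδ).exists
  set ε : ℝ := (2 : ℝ)⁻¹ ^ n
  have hε : 0 < ε := by positivity
  have h2 := (tendsto_rpow_atTop hθ1).atTop_mul_const (Real.rpow_pos_of_pos hε θ)
  have h3 := (tendsto_rpow_atTop hθ.1).atTop_mul_const (Real.rpow_pos_of_pos hε (1 - θ))
  obtain ⟨M, ⟨a, b⟩, c⟩ := (((h2.eventually_ge_atTop C).and (h3.eventually_ge_atTop C)).and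
    (eventually_gt_atTop 0)).exists
  exact ⟨ε, M, hε, c, hn, a, b⟩

end RealInequalities

/-! ### Order structure and geometric means in L⁰. -/

namespace AEFunction

variable {Ω : Type*} [MeasurableSpace Ω] {μ : Measure Ω}

instance isOrderedAddMonoid : IsOrderedAddMonoid (Ω →ₘ[μ] ℝ) where
  add_le_add_left f g h k := by
    refine AEEqFun.coeFn_le.mp ?_
    filter_upwards [AEEqFun.coeFn_le.mpr h, AEEqFun.coeFn_add f k, AEEqFun.coeFn_add g k]
      with t h1 h2 h3
    rw [h2, h3, Pi.add_apply, Pi.add_apply]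
    linarith

theorem smul_nonneg_of_nonneg {c : ℝ} (hc : 0 ≤ c) {f : Ω →ₘ[μ] ℝ} (hf : 0 ≤ f) : 0 ≤ c • f := by
  refine AEEqFun.coeFn_le.mp ?_
  filter_upwards [AEEqFun.coeFn_le.mpr hf, AEEqFun.coeFn_smul c f,
    AEEqFun.coeFn_zero (μ := μ) (β := ℝ)] with t h1 h2 h3
  rw [h3, Pi.zero_apply] at h1 ⊢
  rw [h2, Pi.smul_apply, smul_eq_mul]
  exact mul_nonneg hc h1

instance isOrderedModule : IsOrderedModule ℝ (Ω →ₘ[μ] ℝ) where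
  smul_le_smul_of_nonneg_left c hc f g h := by
    have := smul_nonneg_of_nonneg hc (sub_nonneg.mpr h)
    rwa [smul_sub, sub_nonneg] at this
  smul_le_smul_of_nonneg_right f hf c d h := by
    have := smul_nonneg_of_nonneg (sub_nonneg.mpr h) hf
    rwa [sub_smul, sub_nonneg] at this

theorem nonneg_iff {f : Ω →ₘ[μ] ℝ} : 0 ≤ f ↔ ∀ᵐ t ∂μ, 0 ≤ f t := by
  rw [← AEEqFun.coeFn_le]
  constructor <;> intro h <;>
    filter_upwards [h, AEEqFun.coeFn_zero (μ := μ) (β := ℝ)] with t h1 h2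
  · simpa [h2] using h1
  · simpa [h2] using h1

/-- Relatively uniform limits preserve inequalities. Since a positive operator maps an error ε m • h
to ε m • τ h, this serves in place of order continuity. -/
theorem le_of_forall_le_add_smul {f g h : Ω →ₘ[μ] ℝ} {ε : ℕ → ℝ} (hε : Tendsto ε atTop (𝓝 0))
    (hle : ∀ m, f ≤ g + ε m • h) : f ≤ g := by
  refine AEEqFun.coeFn_le.mp ?_
  have h1 : ∀ m, ∀ᵐ t ∂μ, f t ≤ g t + ε m * h t := fun m => by
    filter_upwards [AEEqFun.coeFn_le.mpr (hle m), AEEqFun.coeFn_add g (ε m • h),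
      AEEqFun.coeFn_smul (ε m) h] with t h1 h2 h3
    simpa [h2, h3] using h1
  filter_upwards [ae_all_iff.mpr h1] with t ht
  have : Tendsto (fun m => g t + ε m * h t) atTop (𝓝 (g t + 0 * h t)) :=
    (hε.mul_const _).const_add _
  simpa using ge_of_tendsto' this ht

theorem exists_sup_of_monotone {u : ℕ → Ω →ₘ[μ] ℝ} (hu : Monotone u) {g : Ω →ₘ[μ] ℝ}
    (hg : ∀ n, u n ≤ g) : ∃ f : Ω →ₘ[μ] ℝ, IsLUB (Set.range u) f ∧
      ∀ᵐ t ∂μ, Tendsto (fun n => u n t) atTop (𝓝 (f t)) := by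
  have hm : AEMeasurable (fun t => ⨆ n, u n t) μ := AEMeasurable.iSup fun n => (u n).aemeasurable
  have hmono : ∀ᵐ t ∂μ, Monotone fun n => u n t := by
    have : ∀ n, ∀ᵐ t ∂μ, u n t ≤ u (n + 1) t := fun n => AEEqFun.coeFn_le.mpr (hu n.le_succ)
    filter_upwards [ae_all_iff.mpr this] with t ht
    exact monotone_nat_of_le_succ ht
  have hbd : ∀ᵐ t ∂μ, ∀ n, u n t ≤ g t := ae_all_iff.mpr fun n => AEEqFun.coeFn_le.mpr (hg n)
  have hlim : ∀ᵐ t ∂μ,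
      Tendsto (fun n => u n t) atTop (𝓝 (AEEqFun.mk _ hm.aestronglyMeasurable t)) := by
    filter_upwards [hmono, hbd, AEEqFun.coeFn_mk _ hm.aestronglyMeasurable] with t h1 h2 h3
    rw [h3]
    exact tendsto_atTop_ciSup h1 ⟨g t, by rintro _ ⟨n, rfl⟩; exact h2 n⟩
  refine ⟨AEEqFun.mk _ hm.aestronglyMeasurable, ⟨?_, ?_⟩, hlim⟩
  · rintro _ ⟨n, rfl⟩
    refine AEEqFun.coeFn_le.mp ?_
    filter_upwards [hmono, hlim] with t h1 h2
    exact h1.ge_of_tendsto h2 n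
  · intro h hh
    refine AEEqFun.coeFn_le.mp ?_
    have : ∀ᵐ t ∂μ, ∀ n, u n t ≤ h t :=
      ae_all_iff.mpr fun n => AEEqFun.coeFn_le.mpr (hh ⟨n, rfl⟩)
    filter_upwards [this, hlim] with t h1 h2
    exact le_of_tendsto' h2 h1

/-- The weighted geometric mean `|f| ^ (1 - θ) * |g| ^ θ`. -/
noncomputable def geomMean (θ : ℝ) (f g : Ω →ₘ[μ] ℝ) : Ω →ₘ[μ] ℝ :=
  AEEqFun.comp₂Measurable (fun a b : ℝ => |a| ^ (1 - θ) * |b| ^ θ)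
    (by unfold Function.uncurry; fun_prop) f g

theorem coeFn_geomMean (θ : ℝ) (f g : Ω →ₘ[μ] ℝ) :
    ∀ᵐ t ∂μ, geomMean θ f g t = |f t| ^ (1 - θ) * |g t| ^ θ :=
  AEEqFun.coeFn_comp₂Measurable _ _ f g

theorem geomMean_nonneg (θ : ℝ) (f g : Ω →ₘ[μ] ℝ) : 0 ≤ geomMean θ f g := by
  rw [nonneg_iff]
  filter_upwards [coeFn_geomMean θ f g] with t h
  rw [h]
  positivity

theorem coeFn_geomMean_of_nonneg (θ : ℝ) {f g : Ω →ₘ[μ] ℝ} (hf : 0 ≤ f) (hg : 0 ≤ g) :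
    ∀ᵐ t ∂μ, 0 ≤ f t ∧ 0 ≤ g t ∧ geomMean θ f g t = (f t) ^ (1 - θ) * (g t) ^ θ := by
  filter_upwards [coeFn_geomMean θ f g, nonneg_iff.mp hf, nonneg_iff.mp hg] with t h h1 h2
  rw [h, abs_of_nonneg h1, abs_of_nonneg h2]
  exact ⟨h1, h2, rfl⟩

variable {θ : ℝ} {f g f' g' : Ω →ₘ[μ] ℝ}

theorem geomMean_mono (hθ : θ ∈ Set.Ioo (0 : ℝ) 1) (hf : 0 ≤ f) (hg : 0 ≤ g) (hff : f ≤ f')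
    (hgg : g ≤ g') : geomMean θ f g ≤ geomMean θ f' g' := by
  refine AEEqFun.coeFn_le.mp ?_
  filter_upwards [coeFn_geomMean_of_nonneg θ hf hg,
    coeFn_geomMean_of_nonneg θ (hf.trans hff) (hg.trans hgg), AEEqFun.coeFn_le.mpr hff,
    AEEqFun.coeFn_le.mpr hgg] with t ⟨h1, h2, h3⟩ ⟨_, _, h4⟩ h5 h6
  rw [h3, h4]
  have := hθ.1.le
  have : 0 ≤ 1 - θ := by linarith [hθ.2]
  gcongr

theorem geomMean_add_le (hθ : θ ∈ Set.Ioo (0 : ℝ) 1) (hf : 0 ≤ f) (hg : 0 ≤ g) (hf' : 0 ≤ f')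
    (hg' : 0 ≤ g') : geomMean θ f g + geomMean θ f' g' ≤ geomMean θ (f + f') (g + g') := by
  refine AEEqFun.coeFn_le.mp ?_
  filter_upwards [coeFn_geomMean_of_nonneg θ hf hg, coeFn_geomMean_of_nonneg θ hf' hg',
    coeFn_geomMean_of_nonneg θ (add_nonneg hf hf') (add_nonneg hg hg'), AEEqFun.coeFn_add f f',
    AEEqFun.coeFn_add g g', AEEqFun.coeFn_add (geomMean θ f g) (geomMean θ f' g')]
    with t ⟨a1, a2, a3⟩ ⟨b1, b2, b3⟩ ⟨_, _, c3⟩ d e k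
  rw [k, c3, d, e, Pi.add_apply, Pi.add_apply, Pi.add_apply, a3, b3]
  exact BanachFunctionLattice.holder_two hθ a1 b1 a2 b2

theorem geomMean_smul (hθ : θ ∈ Set.Ioo (0 : ℝ) 1) {c : ℝ} (hc : 0 ≤ c) (f g : Ω →ₘ[μ] ℝ) :
    geomMean θ (c • f) (c • g) = c • geomMean θ f g := by
  refine AEEqFun.ext ?_
  filter_upwards [coeFn_geomMean θ f g, coeFn_geomMean θ (c • f) (c • g), AEEqFun.coeFn_smul c f,
    AEEqFun.coeFn_smul c g, AEEqFun.coeFn_smul c (geomMean θ f g)] with t h1 h2 h3 h4 h5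
  rw [h5, h2, h3, h4, Pi.smul_apply, Pi.smul_apply, Pi.smul_apply, smul_eq_mul, smul_eq_mul,
    smul_eq_mul, h1, abs_mul, abs_mul, abs_of_nonneg hc, Real.mul_rpow hc (abs_nonneg _),
    Real.mul_rpow hc (abs_nonneg _), mul_mul_mul_comm]
  congr 1
  rcases hc.eq_or_lt with rfl | hc
  · rw [Real.zero_rpow hθ.1.ne', mul_zero]
  · rw [← Real.rpow_add hc]; simp

/-- The linear majorants of `geomMean θ f g` given by Young's inequality with dyadic scaling. -/
noncomputable def dyadicMajorant (θ : ℝ) (j : ℤ) (f g : Ω →ₘ[μ] ℝ) : Ω →ₘ[μ] ℝ :=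
  (((2 : ℝ) ^ j) ^ θ) • f + (((2 : ℝ) ^ j) ^ (θ - 1)) • g

theorem coeFn_dyadicMajorant (θ : ℝ) (j : ℤ) (f g : Ω →ₘ[μ] ℝ) : ∀ᵐ t ∂μ,
    dyadicMajorant θ j f g t = ((2 : ℝ) ^ j) ^ θ * f t + ((2 : ℝ) ^ j) ^ (θ - 1) * g t := by
  filter_upwards [AEEqFun.coeFn_add ((((2 : ℝ) ^ j) ^ θ) • f) ((((2 : ℝ) ^ j) ^ (θ - 1)) • g),
    AEEqFun.coeFn_smul (((2 : ℝ) ^ j) ^ θ) f, AEEqFun.coeFn_smul (((2 : ℝ) ^ j) ^ (θ - 1)) g]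
    with t h1 h2 h3
  rw [dyadicMajorant, h1, Pi.add_apply, h2, h3, Pi.smul_apply, Pi.smul_apply, smul_eq_mul,
    smul_eq_mul]

theorem geomMean_le_dyadicMajorant (hθ : θ ∈ Set.Ioo (0 : ℝ) 1) (hf : 0 ≤ f) (hg : 0 ≤ g) (j : ℤ) :
    geomMean θ f g ≤ dyadicMajorant θ j f g := by
  refine AEEqFun.coeFn_le.mp ?_
  filter_upwards [coeFn_geomMean_of_nonneg θ hf hg, coeFn_dyadicMajorant θ j f g]
    with t ⟨h1, h2, h3⟩ h4
  rw [h3, h4]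
  exact rpow_mul_rpow_le_scaled_add hθ h1 h2 (by positivity)

theorem geomMean_le_add (hθ : θ ∈ Set.Ioo (0 : ℝ) 1) (hf : 0 ≤ f) (hg : 0 ≤ g) :
    geomMean θ f g ≤ f + g := by
  simpa [dyadicMajorant] using geomMean_le_dyadicMajorant hθ hf hg 0

theorem le_geomMean_of_forall_dyadicMajorant (hθ : θ ∈ Set.Ioo (0 : ℝ) 1) (hf : 0 ≤ f) (hg : 0 ≤ g)
    {h : Ω →ₘ[μ] ℝ} (hle : ∀ j, h ≤ dyadicMajorant θ j f g) : h ≤ (3 : ℝ) • geomMean θ f g := by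
  refine AEEqFun.coeFn_le.mp ?_
  filter_upwards [coeFn_geomMean_of_nonneg θ hf hg,
    ae_all_iff.mpr fun j => coeFn_dyadicMajorant θ j f g,
    ae_all_iff.mpr fun j => AEEqFun.coeFn_le.mpr (hle j),
    AEEqFun.coeFn_smul (3 : ℝ) (geomMean θ f g)] with t ⟨h1, h2, h3⟩ h4 h5 h6
  rw [h6, Pi.smul_apply, smul_eq_mul, h3]
  exact le_rpow_mul_rpow_of_forall_zpow hθ h1 h2 fun j => (h4 j) ▸ h5 j

theorem le_geomMean_of_forall_abs_le_dyadicMajorant (hθ : θ ∈ Set.Ioo (0 : ℝ) 1) (hf : 0 ≤ f)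
    (hg : 0 ≤ g) {m : ℕ} (hfg : f ≤ (2 : ℝ) ^ m • g) (hgf : g ≤ (2 : ℝ) ^ m • f) {h : Ω →ₘ[μ] ℝ}
    (hle : ∀ j : ℤ, |j| ≤ m → h ≤ dyadicMajorant θ j f g) : h ≤ (3 : ℝ) • geomMean θ f g := by
  refine AEEqFun.coeFn_le.mp ?_
  have hle' : ∀ᵐ t ∂μ, ∀ j : ℤ, |j| ≤ m → h t ≤ dyadicMajorant θ j f g t :=
    ae_all_iff.mpr fun j => by
      by_cases hj : |j| ≤ m
      · filter_upwards [AEEqFun.coeFn_le.mpr (hle j hj)] with t ht _ using ht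
      · exact ae_of_all _ fun t h => absurd h hj
  filter_upwards [coeFn_geomMean_of_nonneg θ hf hg,
    ae_all_iff.mpr fun j => coeFn_dyadicMajorant θ j f g, hle',
    AEEqFun.coeFn_smul (3 : ℝ) (geomMean θ f g), AEEqFun.coeFn_le.mpr hfg,
    AEEqFun.coeFn_le.mpr hgf, AEEqFun.coeFn_smul ((2 : ℝ) ^ m) f,
    AEEqFun.coeFn_smul ((2 : ℝ) ^ m) g] with t ⟨h1, h2, h3⟩ h4 h5 h6 h7 h8 h9 h10
  rw [h6, Pi.smul_apply, smul_eq_mul, h3]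
  rw [h10] at h7
  rw [h9] at h8
  exact le_rpow_mul_rpow_of_forall_zpow_le hθ h1 h2 h7 h8 fun j hj => (h4 j) ▸ h5 j hj

/-- The truncation of `f` against a dyadic multiple of `g`. -/
noncomputable def trunc (m : ℕ) (f g : Ω →ₘ[μ] ℝ) : Ω →ₘ[μ] ℝ := f ⊓ (2 : ℝ) ^ m • g

theorem trunc_nonneg (m : ℕ) (hf : 0 ≤ f) (hg : 0 ≤ g) : 0 ≤ trunc m f g :=
  le_inf hf (smul_nonneg (by positivity) hg)

theorem trunc_le (m : ℕ) (f g : Ω →ₘ[μ] ℝ) : trunc m f g ≤ f := inf_le_left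

theorem trunc_le_smul (m : ℕ) (f g : Ω →ₘ[μ] ℝ) : trunc m f g ≤ (2 : ℝ) ^ m • g := inf_le_right

theorem trunc_monotone (hg : 0 ≤ g) : Monotone fun m => trunc m f g := fun _ _ h =>
  inf_le_inf le_rfl (smul_le_smul_of_nonneg_right (pow_le_pow_right₀ one_le_two h) hg)

/-- Mutual truncation makes the pair comparable, as `geomMean_map_le` requires. The bound f ≤ 4 ^ m
• f handles the points where the other truncation is active. -/
theorem trunc_le_smul_trunc (m : ℕ) (hf : 0 ≤ f) :
    trunc m f g ≤ (2 : ℝ) ^ m • trunc m g f := by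
  refine AEEqFun.coeFn_le.mp ?_
  filter_upwards [AEEqFun.coeFn_inf f ((2 : ℝ) ^ m • g), AEEqFun.coeFn_inf g ((2 : ℝ) ^ m • f),
    AEEqFun.coeFn_smul ((2 : ℝ) ^ m) f, AEEqFun.coeFn_smul ((2 : ℝ) ^ m) g,
    AEEqFun.coeFn_smul ((2 : ℝ) ^ m) (trunc m g f), nonneg_iff.mp hf]
    with t h1 h2 h3 h4 h5 h6
  rw [h5, Pi.smul_apply, trunc, trunc, h1, h2, h3, h4, Pi.smul_apply, Pi.smul_apply, smul_eq_mul,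
    smul_eq_mul, smul_eq_mul, mul_min_of_nonneg _ _ (by positivity)]
  have : (1 : ℝ) ≤ 2 ^ m := one_le_pow₀ one_le_two
  refine le_min (min_le_right _ _) ((min_le_left _ _).trans ?_)
  nlinarith [mul_nonneg (sub_nonneg.mpr this) h6,
    mul_nonneg (mul_nonneg (sub_nonneg.mpr this) h6) (zero_le_one.trans this)]

theorem geomMean_le_trunc_add (hθ : θ ∈ Set.Ioo (0 : ℝ) 1) (hf : 0 ≤ f) (hg : 0 ≤ g) (m : ℕ) :
    geomMean θ f g ≤
      geomMean θ (trunc m f g) (trunc m g f) + truncationError θ m • (f + g) := by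
  refine AEEqFun.coeFn_le.mp ?_
  filter_upwards [coeFn_geomMean_of_nonneg θ hf hg,
    coeFn_geomMean_of_nonneg θ (trunc_nonneg m hf hg) (trunc_nonneg m hg hf),
    AEEqFun.coeFn_add (geomMean θ (trunc m f g) (trunc m g f)) (truncationError θ m • (f + g)),
    AEEqFun.coeFn_smul (truncationError θ m) (f + g), AEEqFun.coeFn_add f g,
    AEEqFun.coeFn_inf f ((2 : ℝ) ^ m • g), AEEqFun.coeFn_inf g ((2 : ℝ) ^ m • f),
    AEEqFun.coeFn_smul ((2 : ℝ) ^ m) f, AEEqFun.coeFn_smul ((2 : ℝ) ^ m) g]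
    with t ⟨a1, a2, a3⟩ ⟨_, _, b3⟩ c d e k l n o
  rw [a3, c, Pi.add_apply, b3, d, Pi.smul_apply, e, Pi.add_apply, trunc, trunc, k, l, n, o]
  exact rpow_mul_rpow_le_truncation hθ a1 a2 m

theorem geomMean_le_of_other_exponent {θ η : ℝ} (hθ : θ ∈ Set.Ioo (0 : ℝ) 1)
    (hη : η ∈ Set.Ioo (0 : ℝ) 1) (hf : 0 ≤ f) (hg : 0 ≤ g) (hf' : 0 ≤ f') (hg' : 0 ≤ g')
    {C M ε : ℝ} (hM : 0 ≤ M) (hε : 0 ≤ ε) (h : geomMean θ f g ≤ C • geomMean θ f' g')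
    (hC : C ≤ M ^ (1 - θ) * ε ^ θ) (hC' : C ≤ M ^ θ * ε ^ (1 - θ)) :
    geomMean η f g ≤
      M • geomMean η f' g' + (ε ^ η + ε ^ (1 - η)) • geomMean η (f + f') (g + g') := by
  refine AEEqFun.coeFn_le.mp ?_
  filter_upwards [coeFn_geomMean_of_nonneg θ hf hg, coeFn_geomMean_of_nonneg θ hf' hg',
    coeFn_geomMean_of_nonneg η hf hg, coeFn_geomMean_of_nonneg η hf' hg',
    coeFn_geomMean_of_nonneg η (add_nonneg hf hf') (add_nonneg hg hg'),
    AEEqFun.coeFn_add f f', AEEqFun.coeFn_add g g',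
    AEEqFun.coeFn_add (M • geomMean η f' g')
      ((ε ^ η + ε ^ (1 - η)) • geomMean η (f + f') (g + g')),
    AEEqFun.coeFn_smul M (geomMean η f' g'),
    AEEqFun.coeFn_smul (ε ^ η + ε ^ (1 - η)) (geomMean η (f + f') (g + g')),
    AEEqFun.coeFn_le.mpr h, AEEqFun.coeFn_smul C (geomMean θ f' g')]
    with t ⟨a1, a2, a3⟩ ⟨b1, b2, b3⟩ ⟨_, _, c3⟩ ⟨_, _, d3⟩ ⟨_, _, e3⟩ p q r s u v w
  rw [w, Pi.smul_apply, smul_eq_mul, a3, b3] at v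
  rw [r, Pi.add_apply, s, u, Pi.smul_apply, Pi.smul_apply, smul_eq_mul, smul_eq_mul, c3, d3, e3,
    p, q]
  exact rpow_mul_rpow_le_of_other_exponent hθ hη a1 a2 b1 b2 hM hε v hC hC'

end AEFunction

/-! ### Positive balls and dyadic series in a Banach lattice. -/

namespace BanachFunctionLattice

open AEFunction

variable {Ω : Type*} [MeasurableSpace Ω] {μ : Measure Ω} {X X₀ X₁ : BanachFunctionLattice μ}

/-- The nonnegative elements of norm at most `r`. -/
def posBall (X : BanachFunctionLattice μ) (r : ℝ) : Set (Ω →ₘ[μ] ℝ) :=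
  {f | 0 ≤ f ∧ ∃ h : f ∈ X.space, X.nrm ⟨f, h⟩ ≤ r}

theorem mem_of_nonneg_of_le {f g : Ω →ₘ[μ] ℝ} (hf : 0 ≤ f) (hfg : f ≤ g) (hg : g ∈ X.space) :
    f ∈ X.space :=
  X.mem_of_abs_le f g hg (by rwa [abs_of_nonneg hf, abs_of_nonneg (hf.trans hfg)])

theorem mem_posBall_of_le {f g : Ω →ₘ[μ] ℝ} {r : ℝ} (hf : 0 ≤ f) (hfg : f ≤ g)
    (hg : g ∈ X.posBall r) : f ∈ X.posBall r :=
  ⟨hf, mem_of_nonneg_of_le hf hfg hg.2.1, (X.nrm_le_of_abs_le ⟨f, _⟩ ⟨g, hg.2.1⟩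
    (by rwa [abs_of_nonneg hf, abs_of_nonneg (hf.trans hfg)])).trans hg.2.2⟩

theorem posBall_mono {r s : ℝ} (h : r ≤ s) : X.posBall r ⊆ X.posBall s :=
  fun _ hf => ⟨hf.1, hf.2.1, hf.2.2.trans h⟩

theorem smul_mem_posBall {f : Ω →ₘ[μ] ℝ} {r c : ℝ} (hc : 0 ≤ c) (hf : f ∈ X.posBall r) :
    c • f ∈ X.posBall (c * r) := by
  refine ⟨smul_nonneg hc hf.1, X.space.smul_mem c hf.2.1, ?_⟩
  have := map_smul_eq_mul X.nrm c ⟨f, hf.2.1⟩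
  rw [Real.norm_eq_abs, abs_of_nonneg hc] at this
  exact this.trans_le (mul_le_mul_of_nonneg_left hf.2.2 hc)

theorem inv_smul_mem_posBall {f : Ω →ₘ[μ] ℝ} {c : ℝ} (hc : 0 < c) (hf : f ∈ X.posBall c) :
    c⁻¹ • f ∈ X.posBall 1 := by
  simpa [hc.ne'] using smul_mem_posBall (inv_pos.mpr hc).le hf

theorem add_mem_posBall {f g : Ω →ₘ[μ] ℝ} {r s : ℝ} (hf : f ∈ X.posBall r)
    (hg : g ∈ X.posBall s) : f + g ∈ X.posBall (r + s) :=
  ⟨add_nonneg hf.1 hg.1, X.space.add_mem hf.2.1 hg.2.1,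
    (map_add_le_add X.nrm ⟨f, hf.2.1⟩ ⟨g, hg.2.1⟩).trans (add_le_add hf.2.2 hg.2.2)⟩

theorem abs_mem_posBall {f : X.space} {r : ℝ} (hf : X.nrm f ≤ r) :
    |(f : Ω →ₘ[μ] ℝ)| ∈ X.posBall r :=
  ⟨abs_nonneg _, X.abs_mem f.2, (X.nrm_le_of_abs_le ⟨_, X.abs_mem f.2⟩ f
    (by rw [abs_abs])).trans hf⟩

theorem exists_mem_posBall {f : Ω →ₘ[μ] ℝ} (hf : f ∈ X.space) :
    ∃ r : ℝ, 0 < r ∧ |f| ∈ X.posBall r :=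
  ⟨X.nrm ⟨f, hf⟩ + 1, add_pos_of_nonneg_of_pos (apply_nonneg _ _) one_pos,
    abs_mem_posBall (f := ⟨f, hf⟩) (by linarith)⟩

theorem sum_half_pow_mem_posBall {a : ℕ → Ω →ₘ[μ] ℝ} (ha : ∀ k, a k ∈ X.posBall 1) (m n : ℕ) :
    ∑ k ∈ Finset.Ico m n, (2⁻¹ : ℝ) ^ k • a k ∈
      X.posBall (∑ k ∈ Finset.Ico m n, (2⁻¹ : ℝ) ^ k) := by
  induction Finset.Ico m n using Finset.induction_on with
  | empty => exact ⟨by simp, by simp, by simp only [Finset.sum_empty]; exact (map_zero X.nrm).le⟩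
  | insert k s hk ih =>
    rw [Finset.sum_insert hk, Finset.sum_insert hk]
    refine add_mem_posBall ?_ ih
    simpa using smul_mem_posBall (c := (2⁻¹ : ℝ) ^ k) (by positivity) (ha k)

theorem sum_half_pow_Ico_le (m n : ℕ) : ∑ k ∈ Finset.Ico m n, (2⁻¹ : ℝ) ^ k ≤ 2 * 2⁻¹ ^ m := by
  rcases le_total m n with h | h
  · have : ∑ k ∈ Finset.Ico m n, (2⁻¹ : ℝ) ^ k = 2 * 2⁻¹ ^ m - 2 * 2⁻¹ ^ n := by
      rw [geom_sum_Ico (by norm_num) h]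
      ring
    rw [this]
    have : (0 : ℝ) ≤ 2 * 2⁻¹ ^ n := by positivity
    linarith
  · rw [Finset.Ico_eq_empty_of_le h, Finset.sum_empty]
    positivity

/-- A dyadically weighted series in the positive unit ball is bounded. -/
theorem exists_sum_half_pow_le {a : ℕ → Ω →ₘ[μ] ℝ} (ha : ∀ k, a k ∈ X.posBall 1) :
    ∃ s ∈ X.posBall 2, ∀ n, ∑ k ∈ Finset.range n, (2⁻¹ : ℝ) ^ k • a k ≤ s := by
  have hmem : ∀ n, ∑ k ∈ Finset.range n, (2⁻¹ : ℝ) ^ k • a k ∈ X.posBall 2 := fun n => by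
    rw [Finset.range_eq_Ico]
    exact posBall_mono (by simpa using sum_half_pow_Ico_le 0 n) (sum_half_pow_mem_posBall ha 0 n)
  set u : ℕ → X.space := fun n => ⟨_, (hmem n).2.1⟩ with hu
  have hdiff : ∀ m n, m ≤ n → X.nrm (u n - u m) ≤ 2 * 2⁻¹ ^ m := by
    intro m n h
    have h1 : (u n - u m : X.space) = ⟨_, (sum_half_pow_mem_posBall ha m n).2.1⟩ := by
      ext1
      simp only [hu, Submodule.coe_sub]
      rw [Finset.sum_Ico_eq_sub _ h]
    rw [h1]
    exact (sum_half_pow_mem_posBall ha m n).2.2.trans (sum_half_pow_Ico_le m n)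
  have hlim : Tendsto (fun m : ℕ => (2 : ℝ) * 2⁻¹ ^ m) atTop (𝓝 0) := by
    simpa using (tendsto_pow_atTop_nhds_zero_of_lt_one (r := (2⁻¹ : ℝ)) (by positivity)
      (by norm_num)).const_mul 2
  obtain ⟨s, hs⟩ := X.complete u fun ε hε => by
    obtain ⟨N, hN⟩ := (hlim.eventually_lt_const (half_pos hε)).exists
    refine ⟨N, fun m hm n hn => ?_⟩
    have h1 := hdiff N m hm
    have h2 := hdiff N n hn
    have h3 := map_sub_le_add X.nrm (u m - u N) (u n - u N)
    rw [sub_sub_sub_cancel_right] at h3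
    linarith
  have hmono : ∀ m n, m ≤ n → (u m : Ω →ₘ[μ] ℝ) ≤ u n := by
    intro m n h
    rw [← sub_nonneg]
    simp only [hu]
    rw [← Finset.sum_Ico_eq_sub _ h]
    exact (sum_half_pow_mem_posBall ha m n).1
  have hle : ∀ n, (u n : Ω →ₘ[μ] ℝ) ≤ s := by
    intro n
    -- Norm limits of increasing sequences are upper bounds: (u n - s)⁺ is dominated by |u m - s|
    -- for every m ≥ n, so its norm vanishes.
    have hp : ((u n : Ω →ₘ[μ] ℝ) - s)⁺ ∈ X.space := by
      refine X.mem_of_abs_le _ _ (u n - s).2 ?_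
      rw [abs_of_nonneg (posPart_nonneg _), Submodule.coe_sub]
      exact sup_le (le_abs_self _) (abs_nonneg _)
    have h0 : X.nrm ⟨_, hp⟩ ≤ 0 := by
      refine ge_of_tendsto hs ?_
      filter_upwards [eventually_ge_atTop n] with m hm
      refine X.nrm_le_of_abs_le _ _ ?_
      rw [abs_of_nonneg (posPart_nonneg _), Submodule.coe_sub]
      exact sup_le ((sub_le_sub_right (hmono n m hm) _).trans (le_abs_self _)) (abs_nonneg _)
    have h1 := X.eq_zero_of_nrm_eq_zero _ (le_antisymm h0 (apply_nonneg _ _))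
    rw [Submodule.mk_eq_zero, posPart_eq_zero, sub_nonpos] at h1
    exact h1
  refine ⟨s, ⟨by simpa [hu] using hle 0, s.2, ?_⟩, hle⟩
  have h2 : Tendsto (fun n => 2 + X.nrm (u n - s)) atTop (𝓝 (2 + 0)) := hs.const_add 2
  rw [add_zero] at h2
  refine ge_of_tendsto' h2 fun n => ?_
  have h3 := map_sub_le_add X.nrm (u n) (u n - s)
  rw [sub_sub_cancel] at h3
  have h4 : X.nrm (u n) ≤ 2 := (hmem n).2.2
  show X.nrm s ≤ _
  linarith

/-! ### Solidity of Calderón products and their position relative to X₀ ∩ X₁ and X₀ + X₁. -/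

section Calderon

variable {θ : ℝ} {hθ : θ ∈ Set.Ioo (0 : ℝ) 1}

theorem mem_calderonProduct_iff {f : Ω →ₘ[μ] ℝ} : f ∈ calderonProduct X₀ X₁ θ hθ ↔
    ∃ c : ℝ, 0 < c ∧ ∃ a ∈ X₀.posBall 1, ∃ b ∈ X₁.posBall 1, |f| ≤ c • geomMean θ a b := by
  constructor
  · rintro ⟨c, hc, a, b, ha, hb, h⟩
    refine ⟨c, hc, _, abs_mem_posBall ha, _, abs_mem_posBall hb, AEEqFun.coeFn_le.mp ?_⟩
    filter_upwards [h, coeFn_geomMean θ |(a : Ω →ₘ[μ] ℝ)| |(b : Ω →ₘ[μ] ℝ)|,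
      AEEqFun.coeFn_smul c (geomMean θ |(a : Ω →ₘ[μ] ℝ)| |(b : Ω →ₘ[μ] ℝ)|), coeFn_abs f,
      coeFn_abs (a : Ω →ₘ[μ] ℝ), coeFn_abs (b : Ω →ₘ[μ] ℝ)] with t h1 h2 h3 h4 h5 h6
    rw [h3, Pi.smul_apply, smul_eq_mul, h4, h2, h5, h6, abs_abs, abs_abs]
    exact h1
  · rintro ⟨c, hc, a, ha, b, hb, h⟩
    refine ⟨c, hc, ⟨a, ha.2.1⟩, ⟨b, hb.2.1⟩, ha.2.2, hb.2.2, ?_⟩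
    filter_upwards [AEEqFun.coeFn_le.mpr h, coeFn_geomMean θ a b,
      AEEqFun.coeFn_smul c (geomMean θ a b), coeFn_abs f] with t h1 h2 h3 h4
    rw [h3, Pi.smul_apply, smul_eq_mul, h4, h2] at h1
    exact h1

theorem mem_calderonProduct_of_abs_le {f g : Ω →ₘ[μ] ℝ} (hg : g ∈ calderonProduct X₀ X₁ θ hθ)
    (h : |f| ≤ |g|) : f ∈ calderonProduct X₀ X₁ θ hθ := by
  rw [mem_calderonProduct_iff] at hg ⊢
  obtain ⟨c, hc, a, ha, b, hb, hg⟩ := hg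
  exact ⟨c, hc, a, ha, b, hb, h.trans hg⟩

theorem mem_calderonProduct_of_nonneg_of_le {f g : Ω →ₘ[μ] ℝ} (hf : 0 ≤ f) (h : f ≤ g)
    (hg : g ∈ calderonProduct X₀ X₁ θ hθ) : f ∈ calderonProduct X₀ X₁ θ hθ :=
  mem_calderonProduct_of_abs_le hg (by rwa [abs_of_nonneg hf, abs_of_nonneg (hf.trans h)])

theorem abs_mem_calderonProduct {f : Ω →ₘ[μ] ℝ} (hf : f ∈ calderonProduct X₀ X₁ θ hθ) :
    |f| ∈ calderonProduct X₀ X₁ θ hθ := mem_calderonProduct_of_abs_le hf (by rw [abs_abs])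

theorem posPart_mem_calderonProduct {f : Ω →ₘ[μ] ℝ} (hf : f ∈ calderonProduct X₀ X₁ θ hθ) :
    f⁺ ∈ calderonProduct X₀ X₁ θ hθ :=
  mem_calderonProduct_of_nonneg_of_le (posPart_nonneg f) (sup_le (le_abs_self _) (abs_nonneg _))
    (abs_mem_calderonProduct hf)

theorem negPart_mem_calderonProduct {f : Ω →ₘ[μ] ℝ} (hf : f ∈ calderonProduct X₀ X₁ θ hθ) :
    f⁻ ∈ calderonProduct X₀ X₁ θ hθ :=
  mem_calderonProduct_of_nonneg_of_le (negPart_nonneg f) (sup_le (neg_le_abs _) (abs_nonneg _))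
    (abs_mem_calderonProduct hf)

theorem inf_mem_calderonProduct {f g : Ω →ₘ[μ] ℝ} (hf : f ∈ calderonProduct X₀ X₁ θ hθ)
    (hg : g ∈ calderonProduct X₀ X₁ θ hθ) : f ⊓ g ∈ calderonProduct X₀ X₁ θ hθ := by
  rw [inf_eq_sub_posPart_sub]
  exact Submodule.sub_mem _ hf (posPart_mem_calderonProduct (Submodule.sub_mem _ hf hg))

theorem geomMean_mem_calderonProduct (hθ : θ ∈ Set.Ioo (0 : ℝ) 1) {a b : Ω →ₘ[μ] ℝ}
    (ha : a ∈ X₀.space) (hb : b ∈ X₁.space) : geomMean θ a b ∈ calderonProduct X₀ X₁ θ hθ := by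
  refine exists_normalized X₀ X₁ _ ⟨a, ha⟩ ⟨b, hb⟩ ?_
  filter_upwards [coeFn_geomMean θ a b] with t ht
  rw [ht, abs_of_nonneg (by positivity)]

/-- The geometric mean of f with itself is |f|. This places X₀ ∩ X₁ in the products for all
parameters at once, and it is the bridge between θ and η. -/
theorem mem_calderonProduct_of_mem_of_mem {f : Ω →ₘ[μ] ℝ} (h₀ : f ∈ X₀.space)
    (h₁ : f ∈ X₁.space) : f ∈ calderonProduct X₀ X₁ θ hθ := by
  refine mem_calderonProduct_of_abs_le (geomMean_mem_calderonProduct hθ h₀ h₁) (le_of_eq ?_)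
  rw [abs_of_nonneg (geomMean_nonneg _ _ _)]
  refine AEEqFun.ext ?_
  filter_upwards [coeFn_geomMean θ f f, coeFn_abs f] with t h1 h2
  rw [h1, h2]
  rcases (abs_nonneg (f t)).eq_or_lt with h | h
  · rw [← h, Real.zero_rpow hθ.1.ne', mul_zero]
  · rw [← Real.rpow_add h]; simp

theorem mem_sup_of_nonneg_of_le_add {f a b : Ω →ₘ[μ] ℝ} (hf : 0 ≤ f) (ha : a ∈ X₀.space)
    (hb : b ∈ X₁.space) (ha0 : 0 ≤ a) (hb0 : 0 ≤ b) (h : f ≤ a + b) :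
    f ∈ X₀.space ⊔ X₁.space := by
  refine Submodule.mem_sup.mpr ⟨f ⊓ a, mem_of_nonneg_of_le (le_inf hf ha0) inf_le_right ha,
    f - f ⊓ a, mem_of_nonneg_of_le (sub_nonneg.mpr inf_le_left) ?_ hb, by abel⟩
  rw [sub_le_iff_le_add, add_inf]
  exact le_inf (le_add_of_nonneg_left hb0) (by rwa [add_comm])

theorem calderonProduct_le_sup :
    calderonProduct X₀ X₁ θ hθ ≤ X₀.space ⊔ X₁.space := by
  intro f hf
  have key : ∀ g ∈ calderonProduct X₀ X₁ θ hθ, 0 ≤ g → g ∈ X₀.space ⊔ X₁.space := by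
    intro g hg hg0
    obtain ⟨c, hc, a, ha, b, hb, h⟩ := mem_calderonProduct_iff.mp hg
    rw [abs_of_nonneg hg0] at h
    refine mem_sup_of_nonneg_of_le_add hg0 (X₀.space.smul_mem c ha.2.1)
      (X₁.space.smul_mem c hb.2.1) (smul_nonneg hc.le ha.1) (smul_nonneg hc.le hb.1) (h.trans ?_)
    rw [← smul_add]
    exact smul_le_smul_of_nonneg_left (geomMean_le_add hθ ha.1 hb.1) hc.le
  rw [← posPart_sub_negPart f]
  exact Submodule.sub_mem _ (key _ (posPart_mem_calderonProduct hf) (posPart_nonneg f))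
    (key _ (negPart_mem_calderonProduct hf) (negPart_nonneg f))

theorem sum_half_pow_geomMean_le (hθ : θ ∈ Set.Ioo (0 : ℝ) 1) {a b : ℕ → Ω →ₘ[μ] ℝ}
    (ha : ∀ k, 0 ≤ a k) (hb : ∀ k, 0 ≤ b k) (n : ℕ) :
    ∑ k ∈ Finset.range n, (2⁻¹ : ℝ) ^ k • geomMean θ (a k) (b k) ≤
      geomMean θ (∑ k ∈ Finset.range n, (2⁻¹ : ℝ) ^ k • a k)
        (∑ k ∈ Finset.range n, (2⁻¹ : ℝ) ^ k • b k) := by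
  have hp : ∀ u : ℕ → Ω →ₘ[μ] ℝ, (∀ k, 0 ≤ u k) → ∀ k, 0 ≤ (2⁻¹ : ℝ) ^ k • u k :=
    fun u hu k => smul_nonneg (by positivity) (hu k)
  induction n with
  | zero => simpa using geomMean_nonneg θ 0 0
  | succ n ih =>
    rw [Finset.sum_range_succ, Finset.sum_range_succ, Finset.sum_range_succ,
      ← geomMean_smul hθ (by positivity)]
    exact (add_le_add_left ih _).trans (geomMean_add_le hθ (Finset.sum_nonneg fun k _ => hp a ha k)
      (Finset.sum_nonneg fun k _ => hp b hb k) (hp a ha n) (hp b hb n))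

/-- Two-term Hölder makes the mean superadditive, so the series can be summed in X₀ and X₁
separately. This replaces completeness of the Calderón product, which is given no norm here. -/
theorem exists_sum_half_pow_geomMean_le (hθ : θ ∈ Set.Ioo (0 : ℝ) 1) {a b : ℕ → Ω →ₘ[μ] ℝ}
    (ha : ∀ k, a k ∈ X₀.posBall 1) (hb : ∀ k, b k ∈ X₁.posBall 1) :
    ∃ s ∈ X₀.space, ∃ r ∈ X₁.space, 0 ≤ s ∧ 0 ≤ r ∧
      ∀ n, ∑ k ∈ Finset.range n, (2⁻¹ : ℝ) ^ k • geomMean θ (a k) (b k) ≤ geomMean θ s r := by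
  obtain ⟨s, hs, hs'⟩ := exists_sum_half_pow_le ha
  obtain ⟨r, hr, hr'⟩ := exists_sum_half_pow_le hb
  refine ⟨s, hs.2.1, r, hr.2.1, hs.1, hr.1, fun n => ?_⟩
  refine (sum_half_pow_geomMean_le hθ (fun k => (ha k).1) (fun k => (hb k).1) n).trans ?_
  exact geomMean_mono hθ (Finset.sum_nonneg fun k _ => smul_nonneg (by positivity) (ha k).1)
    (Finset.sum_nonneg fun k _ => smul_nonneg (by positivity) (hb k).1) (hs' n) (hr' n)

end Calderon

end BanachFunctionLattice

/-! ### Transfer of disjointness, injectivity and solidity of the range from θ to η. -/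

namespace BanachFunctionLattice

open AEFunction

variable {Ω Ω' : Type*} [MeasurableSpace Ω] [MeasurableSpace Ω'] {μ : Measure Ω} {ν : Measure Ω'}
  {X₀ X₁ : BanachFunctionLattice μ} {Y₀ Y₁ : BanachFunctionLattice ν}

/-- A linear map on `L⁰` which is positive on `X₀ + X₁` and bounded from `X₀` to `Y₀` and from `X₁`
to `Y₁`. -/
structure IsPositiveCoupleMap (X₀ X₁ : BanachFunctionLattice μ) (Y₀ Y₁ : BanachFunctionLattice ν)
    (τ : (Ω →ₘ[μ] ℝ) →ₗ[ℝ] (Ω' →ₘ[ν] ℝ)) : Prop where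
  nonneg : ∀ x ∈ X₀.space ⊔ X₁.space, 0 ≤ x → 0 ≤ τ x
  bounded : ∃ C : ℝ, 0 < C ∧ (∀ x ∈ X₀.posBall 1, τ x ∈ Y₀.posBall C) ∧
    ∀ x ∈ X₁.posBall 1, τ x ∈ Y₁.posBall C

/-- A linear map on `L⁰` which restricts to an order isomorphism of `E` onto `F`. -/
structure IsLatticeIsoOn (τ : (Ω →ₘ[μ] ℝ) →ₗ[ℝ] (Ω' →ₘ[ν] ℝ)) (E : Submodule ℝ (Ω →ₘ[μ] ℝ))
    (F : Submodule ℝ (Ω' →ₘ[ν] ℝ)) : Prop where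
  mapsTo : ∀ x ∈ E, τ x ∈ F
  disjoint : ∀ x ∈ E, ∀ y ∈ E, x ⊓ y = 0 → τ x ⊓ τ y = 0
  injective : ∀ x ∈ E, τ x = 0 → x = 0
  surjective : ∀ y ∈ F, ∃ x ∈ E, τ x = y

theorem trunc_mem_left (m : ℕ) {a b : Ω →ₘ[μ] ℝ} (ha : 0 ≤ a) (hb : 0 ≤ b)
    (hX : a ∈ X₀.space) : trunc m a b ∈ X₀.space :=
  mem_of_nonneg_of_le (trunc_nonneg m ha hb) (trunc_le m a b) hX

theorem trunc_mem_right (m : ℕ) {a b : Ω →ₘ[μ] ℝ} (ha : 0 ≤ a) (hb : 0 ≤ b)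
    (hX : b ∈ X₁.space) : trunc m a b ∈ X₁.space :=
  mem_of_nonneg_of_le (trunc_nonneg m ha hb) (trunc_le_smul m a b) (X₁.space.smul_mem _ hX)

theorem geomMean_mem {X : BanachFunctionLattice μ} {θ : ℝ} (hθ : θ ∈ Set.Ioo (0 : ℝ) 1)
    {a b : Ω →ₘ[μ] ℝ} (ha0 : 0 ≤ a) (hb0 : 0 ≤ b) (ha : a ∈ X.space) (hb : b ∈ X.space) :
    geomMean θ a b ∈ X.space :=
  mem_of_nonneg_of_le (geomMean_nonneg _ _ _) (geomMean_le_add hθ ha0 hb0) (X.space.add_mem ha hb)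

/-- Nonnegative elements of a Calderón product are approximated from below, uniformly relative to an
element of `X₀ + X₁`, by elements of `X₀ ∩ X₁`. -/
theorem exists_approx_mem_inter {θ : ℝ} {hθ : θ ∈ Set.Ioo (0 : ℝ) 1} {f : Ω →ₘ[μ] ℝ}
    (hf : f ∈ calderonProduct X₀ X₁ θ hθ) (hf0 : 0 ≤ f) :
    ∃ q : ℕ → Ω →ₘ[μ] ℝ, Monotone q ∧ (∀ m, 0 ≤ q m) ∧ (∀ m, q m ≤ f) ∧ (∀ m, q m ∈ X₀.space) ∧
      (∀ m, q m ∈ X₁.space) ∧ ∃ h ∈ X₀.space ⊔ X₁.space, 0 ≤ h ∧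
        ∀ m, f ≤ q m + truncationError θ m • h := by
  obtain ⟨c, hc, a, ha, b, hb, hle⟩ := mem_calderonProduct_iff.mp hf
  rw [abs_of_nonneg hf0] at hle
  have hu := fun m => trunc_nonneg m ha.1 hb.1
  have hv := fun m => trunc_nonneg m hb.1 ha.1
  have hg := fun m => smul_nonneg hc.le (geomMean_nonneg θ (trunc m a b) (trunc m b a))
  have hq := fun m => le_inf hf0 (hg m)
  -- Each truncation lies below a multiple of a and a multiple of b, hence in both spaces, and so
  -- does the mean of the two.
  refine ⟨fun m => f ⊓ c • geomMean θ (trunc m a b) (trunc m b a), fun m n hmn => ?_, hq,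
    fun m => inf_le_left, fun m => ?_, fun m => ?_, c • (a + b), ?_, ?_, fun m => ?_⟩
  · exact inf_le_inf le_rfl (smul_le_smul_of_nonneg_left (geomMean_mono hθ (hu m) (hv m)
      (trunc_monotone hb.1 hmn) (trunc_monotone ha.1 hmn)) hc.le)
  · exact mem_of_nonneg_of_le (hq m) inf_le_right (X₀.space.smul_mem _ (geomMean_mem hθ (hu m)
      (hv m) (trunc_mem_left m ha.1 hb.1 ha.2.1) (trunc_mem_right m hb.1 ha.1 ha.2.1)))
  · exact mem_of_nonneg_of_le (hq m) inf_le_right (X₁.space.smul_mem _ (geomMean_mem hθ (hu m)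
      (hv m) (trunc_mem_right m ha.1 hb.1 hb.2.1) (trunc_mem_left m hb.1 ha.1 hb.2.1)))
  · exact Submodule.smul_mem _ _ (Submodule.add_mem_sup ha.2.1 hb.2.1)
  · exact smul_nonneg hc.le (add_nonneg ha.1 hb.1)
  · have h0 : 0 ≤ truncationError θ m • c • (a + b) :=
      smul_nonneg (truncationError_nonneg θ m) (smul_nonneg hc.le (add_nonneg ha.1 hb.1))
    rw [inf_add]
    refine le_inf (le_add_of_nonneg_right h0) (hle.trans ?_)
    rw [smul_comm, ← smul_add]
    exact smul_le_smul_of_nonneg_left (geomMean_le_trunc_add hθ ha.1 hb.1 m) hc.le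

theorem map_dyadicMajorant (τ : (Ω →ₘ[μ] ℝ) →ₗ[ℝ] (Ω' →ₘ[ν] ℝ)) (θ : ℝ) (j : ℤ)
    (f g : Ω →ₘ[μ] ℝ) : τ (dyadicMajorant θ j f g) = dyadicMajorant θ j (τ f) (τ g) := by
  simp [dyadicMajorant]

theorem dyadicMajorant_mem_sup (θ : ℝ) (j : ℤ) {a b : Ω →ₘ[μ] ℝ} (ha : a ∈ X₀.space)
    (hb : b ∈ X₁.space) : dyadicMajorant θ j a b ∈ X₀.space ⊔ X₁.space :=
  Submodule.add_mem_sup (X₀.space.smul_mem _ ha) (X₁.space.smul_mem _ hb)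

section CoupleMap

variable {τ : (Ω →ₘ[μ] ℝ) →ₗ[ℝ] (Ω' →ₘ[ν] ℝ)}

namespace IsLatticeIsoOn

variable {θ : ℝ} {hθ : θ ∈ Set.Ioo (0 : ℝ) 1}

/-- The elements f - f ⊓ g and g - f ⊓ g are disjoint, so disjointness preservation upgrades to
preservation of infima. -/
theorem map_inf (hiso : IsLatticeIsoOn τ (calderonProduct X₀ X₁ θ hθ) (calderonProduct Y₀ Y₁ θ hθ))
    {f g : Ω →ₘ[μ] ℝ} (hf : f ∈ calderonProduct X₀ X₁ θ hθ)
    (hg : g ∈ calderonProduct X₀ X₁ θ hθ) : τ (f ⊓ g) = τ f ⊓ τ g := by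
  have hfg := inf_mem_calderonProduct hf hg
  have h1 := hiso.disjoint _ (Submodule.sub_mem _ hf hfg) _ (Submodule.sub_mem _ hg hfg)
    (by rw [← inf_sub, sub_self])
  rw [map_sub, map_sub, ← inf_sub, sub_eq_zero] at h1
  exact h1.symm

/-- If τ x ≥ 0 then τ x⁻ ≤ τ x⁺. These images are disjoint, so τ x⁻ = 0, and injectivity gives x⁻ =
0. -/
theorem nonneg_of_map_nonneg
    (hiso : IsLatticeIsoOn τ (calderonProduct X₀ X₁ θ hθ) (calderonProduct Y₀ Y₁ θ hθ))
    {x : Ω →ₘ[μ] ℝ} (hx : x ∈ calderonProduct X₀ X₁ θ hθ) (hτ : 0 ≤ τ x) : 0 ≤ x := by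
  have hp := posPart_mem_calderonProduct hx
  have hn := negPart_mem_calderonProduct hx
  have h1 := hiso.disjoint _ hp _ hn (posPart_inf_negPart_eq_zero x)
  rw [← posPart_sub_negPart x, map_sub, sub_nonneg] at hτ
  rw [inf_eq_right.mpr hτ] at h1
  have h2 := hiso.injective _ hn h1
  rwa [negPart_eq_zero] at h2

theorem le_of_map_le
    (hiso : IsLatticeIsoOn τ (calderonProduct X₀ X₁ θ hθ) (calderonProduct Y₀ Y₁ θ hθ))
    {x y : Ω →ₘ[μ] ℝ} (hx : x ∈ calderonProduct X₀ X₁ θ hθ)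
    (hy : y ∈ calderonProduct X₀ X₁ θ hθ) (hτ : τ x ≤ τ y) : x ≤ y := by
  rw [← sub_nonneg] at hτ ⊢
  rw [← map_sub] at hτ
  exact hiso.nonneg_of_map_nonneg (Submodule.sub_mem _ hy hx) hτ

end IsLatticeIsoOn

namespace IsPositiveCoupleMap

theorem mono (h : IsPositiveCoupleMap X₀ X₁ Y₀ Y₁ τ) {x y : Ω →ₘ[μ] ℝ}
    (hx : x ∈ X₀.space ⊔ X₁.space) (hy : y ∈ X₀.space ⊔ X₁.space) (hxy : x ≤ y) : τ x ≤ τ y := by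
  rw [← sub_nonneg, ← map_sub]
  exact h.nonneg _ (Submodule.sub_mem _ hy hx) (sub_nonneg.mpr hxy)

theorem map_mem_left (h : IsPositiveCoupleMap X₀ X₁ Y₀ Y₁ τ) {x : Ω →ₘ[μ] ℝ} (hx : x ∈ X₀.space)
    (hx0 : 0 ≤ x) : τ x ∈ Y₀.space := by
  obtain ⟨C, -, hC, -⟩ := h.bounded
  obtain ⟨r, hr, hxr⟩ := exists_mem_posBall hx
  rw [abs_of_nonneg hx0] at hxr
  have := (hC _ (inv_smul_mem_posBall hr hxr)).2.1
  rw [map_smul] at this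
  simpa [smul_smul, hr.ne'] using Y₀.space.smul_mem r this

theorem map_mem_right (h : IsPositiveCoupleMap X₀ X₁ Y₀ Y₁ τ) {x : Ω →ₘ[μ] ℝ} (hx : x ∈ X₁.space)
    (hx0 : 0 ≤ x) : τ x ∈ Y₁.space := by
  obtain ⟨C, -, -, hC⟩ := h.bounded
  obtain ⟨r, hr, hxr⟩ := exists_mem_posBall hx
  rw [abs_of_nonneg hx0] at hxr
  have := (hC _ (inv_smul_mem_posBall hr hxr)).2.1
  rw [map_smul] at this
  simpa [smul_smul, hr.ne'] using Y₁.space.smul_mem r this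

/-- A positive operator satisfies Hölder's inequality up to a constant. -/
theorem map_le_geomMean (h : IsPositiveCoupleMap X₀ X₁ Y₀ Y₁ τ) {θ : ℝ}
    (hθ : θ ∈ Set.Ioo (0 : ℝ) 1) {f a b : Ω →ₘ[μ] ℝ} (hf : f ∈ X₀.space ⊔ X₁.space)
    (ha : a ∈ X₀.space) (hb : b ∈ X₁.space) (ha0 : 0 ≤ a) (hb0 : 0 ≤ b)
    (hle : f ≤ geomMean θ a b) : τ f ≤ (3 : ℝ) • geomMean θ (τ a) (τ b) := by
  refine le_geomMean_of_forall_dyadicMajorant hθ (h.nonneg _ (Submodule.mem_sup_left ha) ha0)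
    (h.nonneg _ (Submodule.mem_sup_right hb) hb0) fun j => ?_
  rw [← map_dyadicMajorant]
  exact h.mono hf (dyadicMajorant_mem_sup θ j ha hb)
    (hle.trans (geomMean_le_dyadicMajorant hθ ha0 hb0 j))

theorem map_mem_calderonProduct (h : IsPositiveCoupleMap X₀ X₁ Y₀ Y₁ τ) {θ : ℝ}
    {hθ : θ ∈ Set.Ioo (0 : ℝ) 1} {f : Ω →ₘ[μ] ℝ} (hf : f ∈ calderonProduct X₀ X₁ θ hθ) :
    τ f ∈ calderonProduct Y₀ Y₁ θ hθ := by
  have key : ∀ g ∈ calderonProduct X₀ X₁ θ hθ, 0 ≤ g → τ g ∈ calderonProduct Y₀ Y₁ θ hθ := by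
    intro g hg hg0
    obtain ⟨c, hc, a, ha, b, hb, hle⟩ := mem_calderonProduct_iff.mp hg
    rw [abs_of_nonneg hg0, ← geomMean_smul hθ hc.le] at hle
    have ha' := X₀.space.smul_mem c ha.2.1
    have hb' := X₁.space.smul_mem c hb.2.1
    have ha0 := smul_nonneg hc.le ha.1
    have hb0 := smul_nonneg hc.le hb.1
    refine mem_calderonProduct_of_nonneg_of_le (h.nonneg _ (calderonProduct_le_sup hg) hg0)
      (h.map_le_geomMean hθ (calderonProduct_le_sup hg) ha' hb' ha0 hb0 hle)
      (Submodule.smul_mem _ _ (geomMean_mem_calderonProduct hθ (h.map_mem_left ha' ha0)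
        (h.map_mem_right hb' hb0)))
  rw [← posPart_sub_negPart f, map_sub]
  exact Submodule.sub_mem _ (key _ (posPart_mem_calderonProduct hf) (posPart_nonneg f))
    (key _ (negPart_mem_calderonProduct hf) (negPart_nonneg f))

section Iso

variable {θ : ℝ} {hθ : θ ∈ Set.Ioo (0 : ℝ) 1}

/-- The reverse Hölder inequality, up to a constant, for comparable elements of `X₀ ∩ X₁`. -/
theorem geomMean_map_le (h : IsPositiveCoupleMap X₀ X₁ Y₀ Y₁ τ)
    (hiso : IsLatticeIsoOn τ (calderonProduct X₀ X₁ θ hθ) (calderonProduct Y₀ Y₁ θ hθ))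
    {η : ℝ} (hη : η ∈ Set.Ioo (0 : ℝ) 1) {u v : Ω →ₘ[μ] ℝ} {m : ℕ}
    (hu₀ : u ∈ X₀.space) (hu₁ : u ∈ X₁.space) (hv₀ : v ∈ X₀.space) (hv₁ : v ∈ X₁.space)
    (hu : 0 ≤ u) (hv : 0 ≤ v) (huv : u ≤ (2 : ℝ) ^ m • v) (hvu : v ≤ (2 : ℝ) ^ m • u) :
    geomMean η (τ u) (τ v) ≤ (3 : ℝ) • τ (geomMean η u v) := by
  have hu' : u ∈ calderonProduct X₀ X₁ θ hθ := mem_calderonProduct_of_mem_of_mem hu₀ hu₁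
  have hv' : v ∈ calderonProduct X₀ X₁ θ hθ := mem_calderonProduct_of_mem_of_mem hv₀ hv₁
  have hL : ∀ j, dyadicMajorant η j u v ∈ calderonProduct X₀ X₁ θ hθ := fun j =>
    Submodule.add_mem _ (Submodule.smul_mem _ _ hu') (Submodule.smul_mem _ _ hv')
  have hτ : ∀ j, geomMean η (τ u) (τ v) ≤ τ (dyadicMajorant η j u v) := fun j => by
    rw [map_dyadicMajorant]
    exact geomMean_le_dyadicMajorant hη (h.nonneg _ (calderonProduct_le_sup hu') hu)
      (h.nonneg _ (calderonProduct_le_sup hv') hv) j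
  -- A is the infimum of the majorants with |j| ≤ k. It stays in the θ-product, where τ commutes
  -- with infima, although the majorants are those for η.
  have key : ∀ k : ℕ, ∃ A ∈ calderonProduct X₀ X₁ θ hθ,
      (∀ j : ℤ, |j| ≤ k → A ≤ dyadicMajorant η j u v) ∧ geomMean η (τ u) (τ v) ≤ τ A := by
    intro k
    induction k with
    | zero =>
      refine ⟨_, hL 0, fun j hj => ?_, hτ 0⟩
      obtain rfl : j = 0 := abs_nonpos_iff.mp (by simpa using hj)
      exact le_rfl
    | succ k ih =>
      obtain ⟨A, hA, hle, hge⟩ := ih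
      have hi := inf_mem_calderonProduct (hL (k + 1)) (hL (-(k + 1)))
      refine ⟨_, inf_mem_calderonProduct hA hi, fun j hj => ?_, ?_⟩
      · by_cases hjk : |j| ≤ k
        · exact inf_le_left.trans (hle j hjk)
        · have hj' : |j| = k + 1 := by push_cast at hj; omega
          rcases eq_or_eq_neg_of_abs_eq hj' with rfl | rfl
          · exact inf_le_right.trans inf_le_left
          · exact inf_le_right.trans inf_le_right
      · rw [hiso.map_inf hA hi, hiso.map_inf (hL _) (hL _)]
        exact le_inf hge (le_inf (hτ _) (hτ _))
  obtain ⟨A, hA, hle, hge⟩ := key m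
  have h1 := le_geomMean_of_forall_abs_le_dyadicMajorant hη hu hv huv hvu hle
  refine hge.trans ?_
  rw [← map_smul]
  refine h.mono (calderonProduct_le_sup hA) ?_ h1
  exact Submodule.smul_mem _ _ (Submodule.mem_sup_left (geomMean_mem hη hu hv hu₀ hv₀))

/-- Stability of disjointness preservation. -/
theorem map_inf_map_eq_zero (h : IsPositiveCoupleMap X₀ X₁ Y₀ Y₁ τ)
    (hiso : IsLatticeIsoOn τ (calderonProduct X₀ X₁ θ hθ) (calderonProduct Y₀ Y₁ θ hθ))
    {η : ℝ} {hη : η ∈ Set.Ioo (0 : ℝ) 1} {x y : Ω →ₘ[μ] ℝ} (hx : x ∈ calderonProduct X₀ X₁ η hη)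
    (hy : y ∈ calderonProduct X₀ X₁ η hη) (hxy : x ⊓ y = 0) : τ x ⊓ τ y = 0 := by
  have hx0 : 0 ≤ x := hxy.ge.trans inf_le_left
  have hy0 : 0 ≤ y := hxy.ge.trans inf_le_right
  have hxD := calderonProduct_le_sup hx
  have hyD := calderonProduct_le_sup hy
  obtain ⟨q, -, hq0, hqx, hq₀, hq₁, a, ha, ha0, hqa⟩ := exists_approx_mem_inter hx hx0
  obtain ⟨r, -, hr0, hry, hr₀, hr₁, b, hb, hb0, hrb⟩ := exists_approx_mem_inter hy hy0
  refine le_antisymm ?_ (le_inf (h.nonneg _ hxD hx0) (h.nonneg _ hyD hy0))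
  refine le_of_forall_le_add_smul (h := τ (a + b)) (tendsto_truncationError hη) fun m => ?_
  have h1 : q m ⊓ r m = 0 :=
    le_antisymm ((inf_le_inf (hqx m) (hry m)).trans hxy.le) (le_inf (hq0 m) (hr0 m))
  have h2 := hiso.disjoint _ (mem_calderonProduct_of_mem_of_mem (hq₀ m) (hq₁ m)) _
    (mem_calderonProduct_of_mem_of_mem (hr₀ m) (hr₁ m)) h1
  have hab := Submodule.add_mem _ ha hb
  -- The zero on the right is replaced by τ (q m) ⊓ τ (r m), and both entries are enlarged by the
  -- common error.
  rw [← h2, inf_add, ← map_smul, ← map_add, ← map_add]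
  refine inf_le_inf (h.mono hxD ?_ ((hqa m).trans ?_)) (h.mono hyD ?_ ((hrb m).trans ?_))
  · exact Submodule.add_mem _ (Submodule.mem_sup_left (hq₀ m)) (Submodule.smul_mem _ _ hab)
  · gcongr
    · exact truncationError_nonneg η m
    · exact le_add_of_nonneg_right hb0
  · exact Submodule.add_mem _ (Submodule.mem_sup_left (hr₀ m)) (Submodule.smul_mem _ _ hab)
  · gcongr
    · exact truncationError_nonneg η m
    · exact le_add_of_nonneg_left ha0

/-- Stability of injectivity. -/
theorem eq_zero_of_map_eq_zero (h : IsPositiveCoupleMap X₀ X₁ Y₀ Y₁ τ)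
    (hiso : IsLatticeIsoOn τ (calderonProduct X₀ X₁ θ hθ) (calderonProduct Y₀ Y₁ θ hθ))
    {η : ℝ} {hη : η ∈ Set.Ioo (0 : ℝ) 1} {x : Ω →ₘ[μ] ℝ} (hx : x ∈ calderonProduct X₀ X₁ η hη)
    (hτ : τ x = 0) : x = 0 := by
  have key : ∀ y ∈ calderonProduct X₀ X₁ η hη, 0 ≤ y → τ y = 0 → y = 0 := by
    intro y hy hy0 hτy
    obtain ⟨q, -, hq0, hqx, hq₀, hq₁, a, ha, ha0, hqa⟩ := exists_approx_mem_inter hy hy0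
    refine le_antisymm ?_ hy0
    refine le_of_forall_le_add_smul (h := a) (tendsto_truncationError hη) fun m => ?_
    have hqD := Submodule.mem_sup_left (T := X₁.space) (hq₀ m)
    have h1 : τ (q m) = 0 := le_antisymm
      ((h.mono hqD (calderonProduct_le_sup hy) (hqx m)).trans hτy.le) (h.nonneg _ hqD (hq0 m))
    have h2 := hiso.injective _ (mem_calderonProduct_of_mem_of_mem (hq₀ m) (hq₁ m)) h1
    simpa [h2] using hqa m
  have hp := posPart_mem_calderonProduct hx
  have hn := negPart_mem_calderonProduct hx
  -- From τ x = 0 the images of x⁺ and x⁻ coincide; being also disjoint, they vanish, which reduces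
  -- the claim to nonnegative elements.
  have h1 := h.map_inf_map_eq_zero hiso hp hn (posPart_inf_negPart_eq_zero x)
  rw [← posPart_sub_negPart x, map_sub, sub_eq_zero] at hτ
  rw [hτ, inf_idem] at h1
  rw [← posPart_sub_negPart x, key _ hp (posPart_nonneg x) (hτ.trans h1),
    key _ hn (negPart_nonneg x) h1, sub_zero]

/-- The range of a Calderón product is solid in the positive cone. -/
theorem exists_map_eq_of_le (h : IsPositiveCoupleMap X₀ X₁ Y₀ Y₁ τ)
    (hiso : IsLatticeIsoOn τ (calderonProduct X₀ X₁ θ hθ) (calderonProduct Y₀ Y₁ θ hθ))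
    {η : ℝ} {hη : η ∈ Set.Ioo (0 : ℝ) 1} {f : Ω →ₘ[μ] ℝ} (hf : f ∈ calderonProduct X₀ X₁ η hη)
    (hf0 : 0 ≤ f) {y : Ω' →ₘ[ν] ℝ} (hy0 : 0 ≤ y) (hy : y ≤ τ f) :
    ∃ x ∈ calderonProduct X₀ X₁ η hη, τ x = y := by
  obtain ⟨q, hqm, hq0, hqf, hq₀, hq₁, a, ha, ha0, hqa⟩ := exists_approx_mem_inter hf hf0
  have hfD := calderonProduct_le_sup hf
  have hq : ∀ m, q m ∈ calderonProduct X₀ X₁ θ hθ := fun m =>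
    mem_calderonProduct_of_mem_of_mem (hq₀ m) (hq₁ m)
  have hqD : ∀ m, q m ∈ X₀.space ⊔ X₁.space := fun m => calderonProduct_le_sup (hq m)
  have hτq0 : ∀ m, 0 ≤ τ (q m) := fun m => h.nonneg _ (hqD m) (hq0 m)
  -- The truncation y ⊓ τ (q m) belongs to the θ-product, so it has a preimage even though y itself
  -- may not.
  choose x hx hτx using fun m => hiso.surjective (y ⊓ τ (q m))
    (mem_calderonProduct_of_nonneg_of_le (le_inf hy0 (hτq0 m)) inf_le_right (hiso.mapsTo _ (hq m)))
  have hxm : Monotone x := fun m n hmn => hiso.le_of_map_le (hx m) (hx n) (by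
    rw [hτx, hτx]
    exact inf_le_inf le_rfl (h.mono (hqD m) (hqD n) (hqm hmn)))
  have hxq : ∀ m, x m ≤ q m := fun m => hiso.le_of_map_le (hx m) (hq m) (by
    rw [hτx]; exact inf_le_right)
  have hx0 : ∀ m, 0 ≤ x m := fun m => hiso.nonneg_of_map_nonneg (hx m) (by
    rw [hτx]; exact le_inf hy0 (hτq0 m))
  -- Increments of y ⊓ τ (q m) are at most those of τ (q m), and order reflection transports this to
  -- the preimages. Hence x m inherits the relatively uniform convergence of q m, and τ can be
  -- applied to the limit z.
  have hdiff : ∀ m k, m ≤ k → x k ≤ x m + (q k - q m) := by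
    intro m k hmk
    refine hiso.le_of_map_le (hx k)
      (Submodule.add_mem _ (hx m) (Submodule.sub_mem _ (hq k) (hq m))) ?_
    have hle := h.mono (hqD m) (hqD k) (hqm hmk)
    rw [map_add, map_sub, hτx, hτx, inf_add]
    refine le_inf (inf_le_left.trans (le_add_of_nonneg_right (sub_nonneg.mpr hle))) ?_
    rw [add_sub_cancel]
    exact inf_le_right
  obtain ⟨z, hz, -⟩ := exists_sup_of_monotone hxm fun m => (hxq m).trans (hqf m)
  have hxz : ∀ m, x m ≤ z := fun m => hz.1 ⟨m, rfl⟩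
  have hzf : z ≤ f := hz.2 (by rintro _ ⟨m, rfl⟩; exact (hxq m).trans (hqf m))
  have hz' : ∀ m, z ≤ x m + truncationError η m • a := by
    intro m
    refine hz.2 ?_
    rintro _ ⟨k, rfl⟩
    refine (hxm (le_max_left k m)).trans ((hdiff m _ (le_max_right k m)).trans ?_)
    gcongr
    rw [sub_le_iff_le_add']
    exact (hqf _).trans (hqa m)
  have hzE := mem_calderonProduct_of_nonneg_of_le ((hx0 0).trans (hxz 0)) hzf hf
  have hzD := calderonProduct_le_sup hzE
  have hxD : ∀ m, x m ∈ X₀.space ⊔ X₁.space := fun m => calderonProduct_le_sup (hx m)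
  refine ⟨z, hzE, le_antisymm ?_ ?_⟩
  · refine le_of_forall_le_add_smul (h := τ a) (tendsto_truncationError hη) fun m => ?_
    have h1 := h.mono hzD (Submodule.add_mem _ (hxD m) (Submodule.smul_mem _ _ ha)) (hz' m)
    rw [map_add, map_smul, hτx] at h1
    exact h1.trans (add_le_add_left inf_le_left _)
  · refine le_of_forall_le_add_smul (h := τ a) (tendsto_truncationError hη) fun m => ?_
    have h1 := h.mono hfD (Submodule.add_mem _ (hqD m) (Submodule.smul_mem _ _ ha)) (hqa m)
    rw [map_add, map_smul] at h1
    have h2 : 0 ≤ truncationError η m • τ a :=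
      smul_nonneg (truncationError_nonneg η m) (h.nonneg _ ha ha0)
    have h3 : y ≤ τ (x m) + truncationError η m • τ a := by
      rw [hτx, inf_add]
      exact le_inf (le_add_of_nonneg_right h2) (hy.trans h1)
    exact h3.trans (add_le_add_left (h.mono (hxD m) hzD (hxz m)) _)

end Iso

end IsPositiveCoupleMap

end CoupleMap

end BanachFunctionLattice

/-! ### Domination of the target product, and surjectivity. -/

namespace BanachFunctionLattice

open AEFunction

variable {Ω Ω' : Type*} [MeasurableSpace Ω] [MeasurableSpace Ω'] {μ : Measure Ω} {ν : Measure Ω'}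
  {X₀ X₁ : BanachFunctionLattice μ} {Y₀ Y₁ : BanachFunctionLattice ν}
  {τ : (Ω →ₘ[μ] ℝ) →ₗ[ℝ] (Ω' →ₘ[ν] ℝ)} {θ : ℝ} {hθ : θ ∈ Set.Ioo (0 : ℝ) 1}

namespace IsPositiveCoupleMap

/-- The inverse of an order isomorphism between Calderón products is bounded. -/
theorem exists_inverse_bound (h : IsPositiveCoupleMap X₀ X₁ Y₀ Y₁ τ)
    (hiso : IsLatticeIsoOn τ (calderonProduct X₀ X₁ θ hθ) (calderonProduct Y₀ Y₁ θ hθ)) :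
    ∃ C : ℝ, 0 < C ∧ ∀ y₀ ∈ Y₀.posBall 1, ∀ y₁ ∈ Y₁.posBall 1, ∃ x₀ ∈ X₀.posBall 1,
      ∃ x₁ ∈ X₁.posBall 1, geomMean θ y₀ y₁ ≤ C • τ (geomMean θ x₀ x₁) := by
  by_contra! hcon
  -- One factor 2 ^ k of 4 ^ k compensates the weight of the k-th term in the series; the other
  -- eventually exceeds the constant c of a preimage of a majorant of the series.
  choose y₀ hy₀ y₁ hy₁ hy using fun k : ℕ => hcon ((4 : ℝ) ^ k) (by positivity)
  obtain ⟨s, hs, r, hr, -, -, hsum⟩ := exists_sum_half_pow_geomMean_le hθ hy₀ hy₁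
  obtain ⟨x, hx, hτx⟩ := hiso.surjective _ (geomMean_mem_calderonProduct hθ hs hr)
  obtain ⟨c, hc, a, ha, b, hb, hle⟩ := mem_calderonProduct_iff.mp hx
  obtain ⟨k, hk⟩ := pow_unbounded_of_one_lt c (one_lt_two : (1 : ℝ) < 2)
  refine hy k a ha b hb ?_
  have hab := calderonProduct_le_sup (geomMean_mem_calderonProduct hθ ha.2.1 hb.2.1)
  have h1 : (2⁻¹ : ℝ) ^ k • geomMean θ (y₀ k) (y₁ k) ≤ c • τ (geomMean θ a b) := by
    calc (2⁻¹ : ℝ) ^ k • geomMean θ (y₀ k) (y₁ k)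
        ≤ ∑ k ∈ Finset.range (k + 1), (2⁻¹ : ℝ) ^ k • geomMean θ (y₀ k) (y₁ k) :=
          Finset.single_le_sum (f := fun k => (2⁻¹ : ℝ) ^ k • geomMean θ (y₀ k) (y₁ k))
            (fun i _ => smul_nonneg (by positivity) (geomMean_nonneg _ _ _))
            (Finset.self_mem_range_succ k)
      _ ≤ τ x := hτx ▸ hsum (k + 1)
      _ ≤ c • τ (geomMean θ a b) := by
          rw [← map_smul]
          exact h.mono (calderonProduct_le_sup hx) (Submodule.smul_mem _ _ hab)
            ((le_abs_self x).trans hle)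
  have h2 := smul_le_smul_of_nonneg_left h1 (by positivity : (0 : ℝ) ≤ 2 ^ k)
  rw [smul_smul, ← mul_pow, mul_inv_cancel₀ two_ne_zero, one_pow, one_smul, smul_smul] at h2
  refine h2.trans (smul_le_smul_of_nonneg_right ?_ (h.nonneg _ hab (geomMean_nonneg _ _ _)))
  calc (2 : ℝ) ^ k * c ≤ 2 ^ k * 2 ^ k := by gcongr
    _ = 4 ^ k := by rw [← mul_pow]; norm_num

/-- The order continuous parts of `τ x₀` and `τ x₁`: their geometric means are comparable with the
images of the geometric means of `x₀` and `x₁`. -/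
theorem exists_geomMean_comparable (h : IsPositiveCoupleMap X₀ X₁ Y₀ Y₁ τ)
    (hiso : IsLatticeIsoOn τ (calderonProduct X₀ X₁ θ hθ) (calderonProduct Y₀ Y₁ θ hθ))
    {x₀ x₁ : Ω →ₘ[μ] ℝ} (hx₀ : x₀ ∈ X₀.space) (hx₁ : x₁ ∈ X₁.space) (hx₀0 : 0 ≤ x₀)
    (hx₁0 : 0 ≤ x₁) : ∃ z₀ z₁ : Ω' →ₘ[ν] ℝ, 0 ≤ z₀ ∧ 0 ≤ z₁ ∧ z₀ ≤ τ x₀ ∧ z₁ ≤ τ x₁ ∧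
      τ (geomMean θ x₀ x₁) ≤ (3 : ℝ) • geomMean θ z₀ z₁ ∧
      ∀ η ∈ Set.Ioo (0 : ℝ) 1, geomMean η z₀ z₁ ≤ (3 : ℝ) • τ (geomMean η x₀ x₁) := by
  have hx₀D := Submodule.mem_sup_left (T := X₁.space) hx₀
  have hx₁D := Submodule.mem_sup_right (S := X₀.space) hx₁
  set u : ℕ → Ω →ₘ[μ] ℝ := fun m => trunc m x₀ x₁
  set v : ℕ → Ω →ₘ[μ] ℝ := fun m => trunc m x₁ x₀
  have hu : ∀ m, 0 ≤ u m := fun m => trunc_nonneg m hx₀0 hx₁0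
  have hv : ∀ m, 0 ≤ v m := fun m => trunc_nonneg m hx₁0 hx₀0
  have hu₀ : ∀ m, u m ∈ X₀.space := fun m => trunc_mem_left m hx₀0 hx₁0 hx₀
  have hu₁ : ∀ m, u m ∈ X₁.space := fun m => trunc_mem_right m hx₀0 hx₁0 hx₁
  have hv₀ : ∀ m, v m ∈ X₀.space := fun m => trunc_mem_right m hx₁0 hx₀0 hx₀
  have hv₁ : ∀ m, v m ∈ X₁.space := fun m => trunc_mem_left m hx₁0 hx₀0 hx₁
  have huD : ∀ m, u m ∈ X₀.space ⊔ X₁.space := fun m => Submodule.mem_sup_left (hu₀ m)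
  have hvD : ∀ m, v m ∈ X₀.space ⊔ X₁.space := fun m => Submodule.mem_sup_left (hv₀ m)
  have hu_le : ∀ m, u m ≤ x₀ := fun m => trunc_le m x₀ x₁
  have hv_le : ∀ m, v m ≤ x₁ := fun m => trunc_le m x₁ x₀
  have hτu : ∀ m, 0 ≤ τ (u m) := fun m => h.nonneg _ (huD m) (hu m)
  have hτv : ∀ m, 0 ≤ τ (v m) := fun m => h.nonneg _ (hvD m) (hv m)
  -- Since τ need not be order continuous, this supremum may be strictly below τ x₀.
  obtain ⟨z₀, hz₀, hlim₀⟩ := exists_sup_of_monotone (u := fun m => τ (u m)) (g := τ x₀)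
    (fun m n hmn => h.mono (huD m) (huD n) (trunc_monotone hx₁0 hmn))
    fun m => h.mono (huD m) hx₀D (hu_le m)
  obtain ⟨z₁, hz₁, hlim₁⟩ := exists_sup_of_monotone (u := fun m => τ (v m)) (g := τ x₁)
    (fun m n hmn => h.mono (hvD m) (hvD n) (trunc_monotone hx₀0 hmn))
    fun m => h.mono (hvD m) hx₁D (hv_le m)
  have hz₀u : ∀ m, τ (u m) ≤ z₀ := fun m => hz₀.1 ⟨m, rfl⟩
  have hz₁v : ∀ m, τ (v m) ≤ z₁ := fun m => hz₁.1 ⟨m, rfl⟩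
  have hz₀0 : 0 ≤ z₀ := (hτu 0).trans (hz₀u 0)
  have hz₁0 : 0 ≤ z₁ := (hτv 0).trans (hz₁v 0)
  refine ⟨z₀, z₁, hz₀0, hz₁0,
    hz₀.2 (by rintro _ ⟨m, rfl⟩; exact h.mono (huD m) hx₀D (hu_le m)),
    hz₁.2 (by rintro _ ⟨m, rfl⟩; exact h.mono (hvD m) hx₁D (hv_le m)), ?_, fun η hη => ?_⟩
  -- Truncating x₀ and x₁ changes their mean by a null multiple of x₀ + x₁, so its image is
  -- controlled by z₀ and z₁ alone.
  · refine le_of_forall_le_add_smul (h := τ (x₀ + x₁)) (tendsto_truncationError hθ) fun m => ?_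
    have huv : geomMean θ (u m) (v m) ∈ X₀.space ⊔ X₁.space :=
      Submodule.mem_sup_left (geomMean_mem hθ (hu m) (hv m) (hu₀ m) (hv₀ m))
    have h1 := h.mono (calderonProduct_le_sup (geomMean_mem_calderonProduct hθ hx₀ hx₁))
      (Submodule.add_mem _ huv (Submodule.smul_mem _ (truncationError θ m)
        (Submodule.add_mem_sup hx₀ hx₁))) (geomMean_le_trunc_add hθ hx₀0 hx₁0 m)
    rw [map_add, map_smul] at h1
    refine h1.trans (add_le_add_left ?_ _)
    refine (h.map_le_geomMean hθ huv (hu₀ m) (hv₁ m) (hu m) (hv m) le_rfl).trans ?_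
    exact smul_le_smul_of_nonneg_left (geomMean_mono hθ (hτu m) (hτv m) (hz₀u m) (hz₁v m))
      (by norm_num)
  -- The constant in the reverse Hölder inequality does not depend on m, so the bound survives the
  -- a.e. limit.
  · have h1 : ∀ m, geomMean η (τ (u m)) (τ (v m)) ≤ (3 : ℝ) • τ (geomMean η x₀ x₁) := fun m => by
      refine (h.geomMean_map_le hiso hη (m := m) (hu₀ m) (hu₁ m) (hv₀ m) (hv₁ m) (hu m) (hv m)
        (trunc_le_smul_trunc m hx₀0) (trunc_le_smul_trunc m hx₁0)).trans ?_
      refine smul_le_smul_of_nonneg_left (h.mono ?_ ?_ ?_) (by norm_num)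
      · exact Submodule.mem_sup_left (geomMean_mem hη (hu m) (hv m) (hu₀ m) (hv₀ m))
      · exact calderonProduct_le_sup (geomMean_mem_calderonProduct hη hx₀ hx₁)
      · exact geomMean_mono hη (hu m) (hv m) (hu_le m) (hv_le m)
    refine AEEqFun.coeFn_le.mp ?_
    filter_upwards [hlim₀, hlim₁, coeFn_geomMean η z₀ z₁,
      ae_all_iff.mpr fun m => coeFn_geomMean η (τ (u m)) (τ (v m)),
      ae_all_iff.mpr fun m => AEEqFun.coeFn_le.mpr (h1 m)] with t a b c d e
    rw [c]
    have hη0 : 0 ≤ η := hη.1.le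
    have hη1 : 0 ≤ 1 - η := by linarith [hη.2]
    refine le_of_tendsto' (((a.abs).rpow_const (Or.inr hη1)).mul
      ((b.abs).rpow_const (Or.inr hη0))) fun m => ?_
    rw [← d m]
    exact e m

/-- One step of the iteration: the change of exponent leaves a remainder that is again a mean of
unit-ball elements, with factor 1/2. -/
theorem exists_geomMean_le_add_half (h : IsPositiveCoupleMap X₀ X₁ Y₀ Y₁ τ)
    (hiso : IsLatticeIsoOn τ (calderonProduct X₀ X₁ θ hθ) (calderonProduct Y₀ Y₁ θ hθ))
    {η : ℝ} (hη : η ∈ Set.Ioo (0 : ℝ) 1) : ∃ K : ℝ, 0 < K ∧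
      ∀ y₀ ∈ Y₀.posBall 1, ∀ y₁ ∈ Y₁.posBall 1, ∃ x₀ ∈ X₀.posBall 1, ∃ x₁ ∈ X₁.posBall 1,
        ∃ y₀' ∈ Y₀.posBall 1, ∃ y₁' ∈ Y₁.posBall 1,
          geomMean η y₀ y₁ ≤ K • τ (geomMean η x₀ x₁) + (2⁻¹ : ℝ) • geomMean η y₀' y₁' := by
  obtain ⟨C, hC, hinv⟩ := h.exists_inverse_bound hiso
  obtain ⟨B, hB, hB₀, hB₁⟩ := h.bounded
  -- C bounds the inverse and 3 comes from the comparison with z₀, z₁. The error entries lie in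
  -- balls of radius 1 + B, so after normalization δ becomes 1/2.
  obtain ⟨ε, M, hε, hM, hδ, hCM, hCM'⟩ := exists_threshold hθ hη (C * 3)
    (δ := 2⁻¹ * (1 + B)⁻¹) (by positivity)
  refine ⟨M * 3, by positivity, fun y₀ hy₀ y₁ hy₁ => ?_⟩
  obtain ⟨x₀, hx₀, x₁, hx₁, hyx⟩ := hinv y₀ hy₀ y₁ hy₁
  obtain ⟨z₀, z₁, hz₀0, hz₁0, hz₀, hz₁, hxz, hzx⟩ :=
    h.exists_geomMean_comparable hiso hx₀.2.1 hx₁.2.1 hx₀.1 hx₁.1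
  have hz₀B := mem_posBall_of_le hz₀0 hz₀ (hB₀ _ hx₀)
  have hz₁B := mem_posBall_of_le hz₁0 hz₁ (hB₁ _ hx₁)
  have hB1 : 0 < 1 + B := by positivity
  refine ⟨x₀, hx₀, x₁, hx₁, _, inv_smul_mem_posBall hB1 (add_mem_posBall hy₀ hz₀B), _,
    inv_smul_mem_posBall hB1 (add_mem_posBall hy₁ hz₁B), ?_⟩
  have h1 : geomMean θ y₀ y₁ ≤ (C * 3) • geomMean θ z₀ z₁ := by
    rw [mul_smul]
    exact hyx.trans (smul_le_smul_of_nonneg_left hxz hC.le)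
  refine (geomMean_le_of_other_exponent hθ hη hy₀.1 hy₁.1 hz₀0 hz₁0 hM.le hε.le h1 hCM hCM').trans
    (add_le_add ?_ ?_)
  · rw [mul_smul]
    exact smul_le_smul_of_nonneg_left (hzx η hη) hM.le
  · rw [geomMean_smul hη (inv_pos.mpr hB1).le, smul_smul]
    exact smul_le_smul_of_nonneg_right hδ (geomMean_nonneg _ _ _)

/-- Iterating the halving step, the images add up to at most τ of a single mean, by the dyadic
series bound. -/
theorem exists_geomMean_le_map (h : IsPositiveCoupleMap X₀ X₁ Y₀ Y₁ τ)
    (hiso : IsLatticeIsoOn τ (calderonProduct X₀ X₁ θ hθ) (calderonProduct Y₀ Y₁ θ hθ))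
    {η : ℝ} (hη : η ∈ Set.Ioo (0 : ℝ) 1) {y₀ y₁ : Ω' →ₘ[ν] ℝ} (hy₀ : y₀ ∈ Y₀.posBall 1)
    (hy₁ : y₁ ∈ Y₁.posBall 1) :
    ∃ f ∈ calderonProduct X₀ X₁ η hη, 0 ≤ f ∧ geomMean η y₀ y₁ ≤ τ f := by
  obtain ⟨K, hK, hstep⟩ := h.exists_geomMean_le_add_half hiso hη
  choose x₀ x₁ next₀ next₁ hx₀ hx₁ hn₀ hn₁ hnext using
    show ∀ p : Y₀.posBall 1 × Y₁.posBall 1, ∃ (x₀ x₁ : Ω →ₘ[μ] ℝ) (y₀' y₁' : Ω' →ₘ[ν] ℝ),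
      x₀ ∈ X₀.posBall 1 ∧ x₁ ∈ X₁.posBall 1 ∧ y₀' ∈ Y₀.posBall 1 ∧ y₁' ∈ Y₁.posBall 1 ∧
        geomMean η (p.1 : Ω' →ₘ[ν] ℝ) (p.2 : Ω' →ₘ[ν] ℝ) ≤
          K • τ (geomMean η x₀ x₁) + (2⁻¹ : ℝ) • geomMean η y₀' y₁' by
      rintro ⟨⟨p₀, hp₀⟩, ⟨p₁, hp₁⟩⟩
      obtain ⟨a, ha, b, hb, c, hc, d, hd, hle⟩ := hstep p₀ hp₀ p₁ hp₁
      exact ⟨a, b, c, d, ha, hb, hc, hd, hle⟩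
  let p : ℕ → Y₀.posBall 1 × Y₁.posBall 1 := fun n =>
    Nat.rec (⟨y₀, hy₀⟩, ⟨y₁, hy₁⟩) (fun _ q => (⟨next₀ q, hn₀ q⟩, ⟨next₁ q, hn₁ q⟩)) n
  have hp : ∀ n, geomMean η ((p n).1 : Ω' →ₘ[ν] ℝ) (p n).2 ≤
      K • τ (geomMean η (x₀ (p n)) (x₁ (p n))) +
        (2⁻¹ : ℝ) • geomMean η ((p (n + 1)).1 : Ω' →ₘ[ν] ℝ) (p (n + 1)).2 := fun n => hnext (p n)
  obtain ⟨s, hs, r, hr, -, -, hsr⟩ := exists_sum_half_pow_geomMean_le hη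
    (fun n => hx₀ (p n)) (fun n => hx₁ (p n))
  obtain ⟨s', hs', r', hr', -, -, hsr'⟩ := exists_sum_half_pow_geomMean_le hη
    (fun n => (p n).1.2) (fun n => (p n).2.2)
  have hmem := geomMean_mem_calderonProduct hη hs hr
  have hterm : ∀ n, geomMean η (x₀ (p n)) (x₁ (p n)) ∈ X₀.space ⊔ X₁.space := fun n =>
    calderonProduct_le_sup (geomMean_mem_calderonProduct hη (hx₀ (p n)).2.1 (hx₁ (p n)).2.1)
  have hiter : ∀ n, geomMean η y₀ y₁ ≤
      K • τ (∑ k ∈ Finset.range n, (2⁻¹ : ℝ) ^ k • geomMean η (x₀ (p k)) (x₁ (p k))) +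
        (2⁻¹ : ℝ) ^ n • geomMean η ((p n).1 : Ω' →ₘ[ν] ℝ) (p n).2 := by
    intro n
    induction n with
    | zero => simp [p]
    | succ n ih =>
      refine ih.trans ?_
      rw [Finset.sum_range_succ, map_add, smul_add, add_assoc]
      gcongr
      rw [map_smul, smul_comm K, pow_succ, mul_smul, ← smul_add]
      exact smul_le_smul_of_nonneg_left (hp n) (by positivity)
  have hle : ∀ n, geomMean η y₀ y₁ ≤ K • τ (geomMean η s r) +
      (2⁻¹ : ℝ) ^ n • geomMean η ((p n).1 : Ω' →ₘ[ν] ℝ) (p n).2 := fun n => by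
    refine (hiter n).trans (add_le_add_left (smul_le_smul_of_nonneg_left (h.mono
      (Submodule.sum_mem _ fun k _ => Submodule.smul_mem _ _ (hterm k))
      (calderonProduct_le_sup hmem) (hsr n)) hK.le) _)
  refine ⟨K • geomMean η s r, Submodule.smul_mem _ _ hmem,
    smul_nonneg hK.le (geomMean_nonneg _ _ _), ?_⟩
  rw [map_smul]
  -- The excess over K • τ (geomMean η s r) is below every remainder. The remainders have partial
  -- sums bounded by geomMean η s' r', so n + 1 copies of the excess lie below that element and the
  -- Archimedean property applies.
  refine le_of_forall_le_add_smul (h := geomMean η s' r')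
    (tendsto_one_div_add_atTop_nhds_zero_nat (𝕜 := ℝ)) fun n => ?_
  rw [← sub_le_iff_le_add']
  have hsum : ((n : ℝ) + 1) • (geomMean η y₀ y₁ - K • τ (geomMean η s r)) ≤ geomMean η s' r' := by
    refine le_trans ?_ (hsr' (n + 1))
    have := Finset.card_nsmul_le_sum (Finset.range (n + 1))
      (fun k => (2⁻¹ : ℝ) ^ k • geomMean η ((p k).1 : Ω' →ₘ[ν] ℝ) (p k).2)
      (geomMean η y₀ y₁ - K • τ (geomMean η s r)) fun k _ => sub_le_iff_le_add'.mpr (hle k)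
    rw [Finset.card_range, ← Nat.cast_smul_eq_nsmul ℝ, Nat.cast_add_one] at this
    exact this
  have hn : (0 : ℝ) < (n : ℝ) + 1 := by positivity
  have := smul_le_smul_of_nonneg_left hsum (one_div_pos.mpr hn).le
  rwa [smul_smul, one_div_mul_cancel hn.ne', one_smul] at this

/-- A positive operator between couples which is an order isomorphism between the Calderón products
for one parameter is one for every parameter. -/
theorem isLatticeIsoOn_of_isLatticeIsoOn (h : IsPositiveCoupleMap X₀ X₁ Y₀ Y₁ τ)
    (hiso : IsLatticeIsoOn τ (calderonProduct X₀ X₁ θ hθ) (calderonProduct Y₀ Y₁ θ hθ))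
    {η : ℝ} (hη : η ∈ Set.Ioo (0 : ℝ) 1) :
    IsLatticeIsoOn τ (calderonProduct X₀ X₁ η hη) (calderonProduct Y₀ Y₁ η hη) where
  mapsTo _ hx := h.map_mem_calderonProduct hx
  disjoint _ hx _ hy hxy := h.map_inf_map_eq_zero hiso hx hy hxy
  injective _ hx hτ := h.eq_zero_of_map_eq_zero hiso hx hτ
  surjective y hy := by
    have key : ∀ y ∈ calderonProduct Y₀ Y₁ η hη, 0 ≤ y →
        ∃ x ∈ calderonProduct X₀ X₁ η hη, τ x = y := by
      intro y hy hy0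
      obtain ⟨c, hc, a, ha, b, hb, hle⟩ := mem_calderonProduct_iff.mp hy
      rw [abs_of_nonneg hy0] at hle
      obtain ⟨f, hf, hf0, hfle⟩ := h.exists_geomMean_le_map hiso hη ha hb
      refine h.exists_map_eq_of_le hiso (Submodule.smul_mem _ c hf) (smul_nonneg hc.le hf0) hy0 ?_
      rw [map_smul]
      exact hle.trans (smul_le_smul_of_nonneg_left hfle hc.le)
    obtain ⟨a, ha, hτa⟩ := key _ (posPart_mem_calderonProduct hy) (posPart_nonneg y)
    obtain ⟨b, hb, hτb⟩ := key _ (negPart_mem_calderonProduct hy) (negPart_nonneg y)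
    exact ⟨a - b, Submodule.sub_mem _ ha hb, by rw [map_sub, hτa, hτb, posPart_sub_negPart]⟩

end IsPositiveCoupleMap

end BanachFunctionLattice

/-! ### Passage between the operator T on X₀ + X₁ and a linear map τ on L⁰. -/

section Transfer

open BanachFunctionLattice

variable {Ω Ω' : Type*} [MeasurableSpace Ω] [MeasurableSpace Ω'] {μ : Measure Ω} {ν : Measure Ω'}
  {X₀ X₁ : BanachFunctionLattice μ} {Y₀ Y₁ : BanachFunctionLattice ν}

theorem restrictsToLatticeIso_iff {D : Submodule ℝ (Ω →ₘ[μ] ℝ)} {R : Submodule ℝ (Ω' →ₘ[ν] ℝ)}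
    {T : D →ₗ[ℝ] R} {τ : (Ω →ₘ[μ] ℝ) →ₗ[ℝ] (Ω' →ₘ[ν] ℝ)} (hτ : ∀ x : D, τ x = T x)
    {E : Submodule ℝ (Ω →ₘ[μ] ℝ)} {F : Submodule ℝ (Ω' →ₘ[ν] ℝ)} (hE : E ≤ D) :
    RestrictsToLatticeIso T E F ↔ IsLatticeIsoOn τ E F := by
  constructor
  · rintro ⟨S, hS, hdisj, hinj, hsurj⟩
    have hτS : ∀ x : E, τ x = S x := fun x => by
      obtain ⟨hx, h⟩ := hS x
      rw [h, ← hτ]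
    refine ⟨fun x hx => ?_, fun x hx y hy hxy => ?_, fun x hx h => ?_, fun y hy => ?_⟩
    · rw [hτS ⟨x, hx⟩]
      exact (S _).2
    · rw [hτS ⟨x, hx⟩, hτS ⟨y, hy⟩]
      exact hdisj _ _ hxy
    · rw [hτS ⟨x, hx⟩, ZeroMemClass.coe_eq_zero, map_eq_zero_iff S hinj] at h
      exact congrArg Subtype.val h
    · obtain ⟨x, hx⟩ := hsurj ⟨y, hy⟩
      exact ⟨x, x.2, by rw [hτS, hx]⟩
  · intro h
    refine ⟨τ.restrict h.mapsTo, fun x => ⟨hE x.2, hτ ⟨x, hE x.2⟩⟩, ⟨fun x y hxy => ?_, ?_, ?_⟩⟩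
    · exact h.disjoint x x.2 y y.2 hxy
    · refine (injective_iff_map_eq_zero _).mpr fun x hx => ?_
      exact Subtype.ext (h.injective x x.2 (congrArg Subtype.val hx))
    · rintro ⟨y, hy⟩
      obtain ⟨x, hx, rfl⟩ := h.surjective y hy
      exact ⟨⟨x, hx⟩, rfl⟩

theorem IsCoupleOperator.isPositiveCoupleMap
    {T : ↥(X₀.space ⊔ X₁.space) →ₗ[ℝ] ↥(Y₀.space ⊔ Y₁.space)} (hT : IsCoupleOperator T)
    (hTpos : IsPositiveOperator T) {τ : (Ω →ₘ[μ] ℝ) →ₗ[ℝ] (Ω' →ₘ[ν] ℝ)}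
    (hτ : ∀ x : ↥(X₀.space ⊔ X₁.space), τ x = T x) : IsPositiveCoupleMap X₀ X₁ Y₀ Y₁ τ where
  nonneg x hx hx0 := hτ ⟨x, hx⟩ ▸ hTpos ⟨x, hx⟩ hx0
  bounded := by
    obtain ⟨C₀, h₀⟩ := hT.bounded_zero
    obtain ⟨C₁, h₁⟩ := hT.bounded_one
    have hbd : ∀ C r : ℝ, 0 ≤ r → r ≤ 1 → C * r ≤ |C| := fun C r hr0 hr1 =>
      (mul_le_mul_of_nonneg_right (le_abs_self C) hr0).trans
        (mul_le_of_le_one_right (abs_nonneg C) hr1)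
    -- The given constants carry no sign, hence the absolute values; the 1 makes the bound strictly
    -- positive.
    refine ⟨|C₀| + |C₁| + 1, by positivity, fun x hx => ?_, fun x hx => ?_⟩
    · obtain ⟨hy, hle⟩ := h₀ ⟨x, hx.2.1⟩
      have hx' := Submodule.mem_sup_left (T := X₁.space) hx.2.1
      rw [hτ ⟨x, hx'⟩]
      refine ⟨hTpos ⟨x, hx'⟩ hx.1, hy, hle.trans ?_⟩
      linarith [hbd C₀ _ (apply_nonneg X₀.nrm ⟨x, hx.2.1⟩) hx.2.2, abs_nonneg C₁]
    · obtain ⟨hy, hle⟩ := h₁ ⟨x, hx.2.1⟩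
      have hx' := Submodule.mem_sup_right (S := X₀.space) hx.2.1
      rw [hτ ⟨x, hx'⟩]
      refine ⟨hTpos ⟨x, hx'⟩ hx.1, hy, hle.trans ?_⟩
      linarith [hbd C₁ _ (apply_nonneg X₁.nrm ⟨x, hx.2.1⟩) hx.2.2, abs_nonneg C₀]

end Transfer

theorem mainTheorem10 {Ω Ω' : Type*} [MeasurableSpace Ω] [MeasurableSpace Ω']
    (μ : Measure Ω) (ν : Measure Ω') [SigmaFinite μ] [SigmaFinite ν]
    (X₀ X₁ : BanachFunctionLattice μ) (Y₀ Y₁ : BanachFunctionLattice ν)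
    (hX₀ : X₀.HasFatouProperty) (hX₁ : X₁.HasFatouProperty)
    (hY₀ : Y₀.HasFatouProperty) (hY₁ : Y₁.HasFatouProperty)
    (T : ↥(X₀.space ⊔ X₁.space) →ₗ[ℝ] ↥(Y₀.space ⊔ Y₁.space))
    (hT : IsCoupleOperator T)
    (hTpos : IsPositiveOperator T)
    (θ₀ : ℝ) (hθ₀ : θ₀ ∈ Set.Ioo (0 : ℝ) 1)
    (hiso : RestrictsToLatticeIso T (X₀.calderonProduct X₁ θ₀ hθ₀)
      (Y₀.calderonProduct Y₁ θ₀ hθ₀))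
    (θ₁ : ℝ) (hθ₁ : θ₁ ∈ Set.Ioo (0 : ℝ) 1) :
    RestrictsToLatticeIso T (X₀.calderonProduct X₁ θ₁ hθ₁)
      (Y₀.calderonProduct Y₁ θ₁ hθ₁) := by
  -- An arbitrary algebraic extension to L⁰ suffices: every Calderón product lies in X₀ + X₁, and
  -- values of τ elsewhere play no role.
  obtain ⟨τ, hτ⟩ := LinearMap.exists_extend ((Y₀.space ⊔ Y₁.space).subtype ∘ₗ T)
  have hτ' : ∀ x : ↥(X₀.space ⊔ X₁.space), τ x = T x := fun x => LinearMap.congr_fun hτ x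
  have h := hT.isPositiveCoupleMap hTpos hτ'
  rw [restrictsToLatticeIso_iff hτ' BanachFunctionLattice.calderonProduct_le_sup] at hiso ⊢
  exact h.isLatticeIsoOn_of_isLatticeIsoOn hiso hθ₁
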